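/- Let $X$ be a connected smooth manifold (finite-dimensional, Hausdorff, second countable, without boundary) and let $n$ be a natural number. Let $\mathcal R=(\mathcal E,\phi)$ be an $\mathbb A_n$-type quiver bundle over $X$ with all arrows oriented in the same direction, that is, smooth real vector bundles of finite rank $\mathcal E_1,\dots,\mathcal E_n$ over $X$ together with morphisms of smooth vector bundles $$\mathcal E_1\xrightarrow{\ \phi_1\ }\mathcal E_2\xrightarrow{\ \phi_2\ }\cdots\xrightarrow{\ \phi_{n-1}\ }\mathcal E_n .$$ A smooth relative connection on $\mathcal R$ (with trivial twisting) is a collection of smooth connections $\nabla_i:\mathcal E_i\to T_X^*\otimes\mathcal E_i$, $1\le i\le n$, such that $$\nabla_{i+1}\circ\phi_i=(\mathrm{id}_{T_X^*}\otimes\phi_i)\circ\nabla_i\qquad\text{for } 1\le i\le n-1 .$$ Then $\mathcal R$ admits a smooth relative connection if and only if every path morphism $$\phi_{(i,j)}:=\phi_i\circ\phi_{i-1}\circ\cdots\circ\phi_j:\mathcal E_j\to\mathcal E_{i+1},\qquad 1\le j\le i\le n-1,$$ has constant rank, that is, the rank of the linear map $\phi_{(i,j),x}:(\mathcal E_j)_x\to(\mathcal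 E_{i+1})_x$ does not depend on $x\in X$. -/

import Mathlib

open Bundle
open scoped Manifold ContDiff

universe u v w

noncomputable section

namespace QuiverConn

section

variable (E : Type*) [NormedAddCommGroup E] [NormedSpace ℝ E]
  (X : Type*) [TopologicalSpace X] [ChartedSpace E X]

/-- A smooth real vector bundle of finite rank over the manifold `X` (modelled on `E`), with
model fibre `F` and fibres `V x`. -/
structure SmoothVectorBundle where
  /-- The model fibre. -/
  F : Type u
  [normedF : NormedAddCommGroup F]
  [normedSpaceF : NormedSpace ℝ F]
  [finiteF : FiniteDimensional ℝ F]
  /-- The fibres. -/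
  V : X → Type v
  [addV : ∀ x, AddCommGroup (V x)]
  [moduleV : ∀ x, Module ℝ (V x)]
  [topV : ∀ x, TopologicalSpace (V x)]
  [topAddV : ∀ x, IsTopologicalAddGroup (V x)]
  [smulV : ∀ x, ContinuousSMul ℝ (V x)]
  [topTotal : TopologicalSpace (TotalSpace F V)]
  [fiberBundle : FiberBundle F V]
  [vectorBundle : VectorBundle ℝ F V]
  [smoothBundle : ContMDiffVectorBundle ∞ F V 𝓘(ℝ, E)]

attribute [instance] SmoothVectorBundle.normedF SmoothVectorBundle.normedSpaceF
  SmoothVectorBundle.finiteF SmoothVectorBundle.addV SmoothVectorBundle.moduleV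
  SmoothVectorBundle.topV SmoothVectorBundle.topAddV SmoothVectorBundle.smulV
  SmoothVectorBundle.topTotal SmoothVectorBundle.fiberBundle SmoothVectorBundle.vectorBundle
  SmoothVectorBundle.smoothBundle

variable {E X}

/-- The section `σ` of the bundle `A` is smooth on the set `U`. -/
def SmoothVectorBundle.SmoothOn (A : SmoothVectorBundle.{u, v} E X) (U : Set X)
    (σ : ∀ x, A.V x) : Prop :=
  ContMDiffOn 𝓘(ℝ, E) (𝓘(ℝ, E).prod 𝓘(ℝ, A.F)) ∞
    (fun x => (TotalSpace.mk' A.F x (σ x) : TotalSpace A.F A.V)) U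

/-- A morphism of smooth vector bundles over `X`: a family of linear maps between the fibres
which is smooth as a section of the Hom bundle. -/
structure VBHom (A B : SmoothVectorBundle.{u, v} E X) where
  /-- The map on fibres. -/
  app : ∀ x, A.V x →L[ℝ] B.V x
  smooth : ContMDiff 𝓘(ℝ, E) (𝓘(ℝ, E).prod 𝓘(ℝ, A.F →L[ℝ] B.F)) ∞
    (fun x => (TotalSpace.mk' (A.F →L[ℝ] B.F) x (app x) :
      TotalSpace (A.F →L[ℝ] B.F) (fun x => A.V x →L[ℝ] B.V x)))

/-- The fibrewise maps `f x` all have the same rank. -/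
def HasConstantRank {A B : SmoothVectorBundle.{u, v} E X} (f : ∀ x, A.V x →L[ℝ] B.V x) : Prop :=
  ∃ r : ℕ, ∀ x, Module.finrank ℝ (LinearMap.range (f x : A.V x →ₗ[ℝ] B.V x)) = r

variable (E X)

/-- A `Q`-bundle over `X`: a representation of the quiver `Q` in smooth vector bundles. -/
structure QuiverBundle (Q : Type*) [Quiver.{w} Q] where
  /-- The bundle at a vertex. -/
  bundle : Q → SmoothVectorBundle.{u, v} E X
  /-- The morphism attached to an arrow. -/
  map : ∀ {i j : Q}, (i ⟶ j) → VBHom (bundle i) (bundle j)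

variable {E X}

/-- The path morphism: the composite of the morphisms attached to the arrows of a path (the
identity for a path of length zero), fibre by fibre. -/
def QuiverBundle.pathMap {Q : Type*} [Quiver.{w} Q] (R : QuiverBundle.{u, v} E X Q) {i : Q} :
    ∀ {j : Q}, Quiver.Path i j → ∀ x, (R.bundle i).V x →L[ℝ] (R.bundle j).V x
  | _, .nil, x => ContinuousLinearMap.id ℝ ((R.bundle i).V x)
  | _, .cons p a, x => ((R.map a).app x).comp (R.pathMap p x)

/-- A smooth relative connection on a `Q`-bundle (with trivial twisting): a smooth connection on
each bundle such that `∇ (φ σ) = φ (∇ σ)` for each arrow and each local smooth section `σ`.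
Mathlib's covariant derivatives take sections defined on all of `X`; a local section on `U` is
represented by any extension, whose covariant derivative on `U` depends only on its values
on `U`. -/
structure RelativeConnection [IsManifold 𝓘(ℝ, E) ∞ X] {Q : Type*} [Quiver.{w} Q]
    (R : QuiverBundle.{u, v} E X Q) where
  /-- The connection at a vertex. -/
  conn : ∀ i, CovariantDerivative 𝓘(ℝ, E) (R.bundle i).F (R.bundle i).V
  smooth : ∀ i, CovariantDerivative.ContMDiffCovariantDerivative (conn i) ∞
  compatible : ∀ {i j : Q} (a : i ⟶ j) (U : Set X), IsOpen U →
    ∀ σ : ∀ x, (R.bundle i).V x, (R.bundle i).SmoothOn U σ → ∀ x ∈ U,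
      conn j (fun y => (R.map a).app y (σ y)) x = ((R.map a).app x).comp (conn i σ x)

end

/-- The vertices of the quiver `1 ⟶ 2 ⟶ ⋯ ⟶ n`, labelled by `0, …, n - 1`. -/
structure LinearA (n : ℕ) where
  /-- The position of the vertex. -/
  pos : Fin n

/-- There is exactly one arrow from each vertex to its successor, and no other arrow. -/
instance (n : ℕ) : Quiver.{0} (LinearA n) where
  Hom i j := PLift (i.pos.val + 1 = j.pos.val)

end QuiverConn

end

/-! Necessity. In trivializations, a morphism intertwining two smooth connections becomes a family
of matrices `f` with `df = f a - b f`, where `a` and `b` are the connection forms. Near a point `u₀`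
there is a smooth `κ` with `κ f κ = κ`, of the same rank as `f u₀`, so `f` has that rank exactly
where the defect `f - f κ f` vanishes. Since `dκ = -κ (df) κ`, the defect solves a homogeneous
linear ODE along segments issuing from `u₀`, where it is zero; by Grönwall it is zero nearby
(`eventually_clmRank_eq_of_hasFDerivAt`). Path morphisms also intertwine the connections, so their
ranks are locally constant, hence constant by connectedness.

Sufficiency. It is enough to make the quiver bundle isomorphic, near each `x₀`, to the constant
representation given by its fibre at `x₀`: the trivial connections of that representation are
compatible, and affine combinations of compatible connections are compatible, so a partition of
unity finishes (`nonempty_relativeConnection_of_local`). The isomorphism is a family `G i` with `G i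
x₀ = 1` and `G j x ∘ φ x₀ = φ x ∘ G i x`, built vertex by vertex. On the image of `φ x₀` the value
of `G j` is forced, and it is well defined only if `G i` carries kernels at `x₀` into kernels at
`x`. The induction therefore demands this for the kernels of all outgoing paths. These form an
increasing flag, of locally constant dimension by hypothesis, and the forced value extends along it
(`exists_extension_preserving_chain`). -/

noncomputable section

open Filter Topology

namespace QuiverConn

/-! ### Projections adapted to two subspaces -/

section LinearAlgebra

variable {F : Type*} [AddCommGroup F] [Module ℝ F]

/-- Every submodule `A` is the range of an idempotent preserving a given submodule `B`. -/
theorem exists_projection_preserving (A B : Submodule ℝ F) :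
    ∃ q : F →ₗ[ℝ] F, (∀ v, q v ∈ A) ∧ (∀ v ∈ A, q v = v) ∧ ∀ v ∈ B, q v ∈ B := by
  obtain ⟨C', hd, hs⟩ := exists_isCompl (A ⊓ B)
  -- `C' ⊓ B` complements `A ⊓ B` inside `B` and misses `A`. A complement `D` of `A` containing it
  -- makes the projection along `D` preserve `B`.
  have hC : Disjoint A (C' ⊓ B) := by
    rw [disjoint_iff] at hd ⊢
    rw [← hd]
    ac_rfl
  have hB : A ⊓ B ⊔ C' ⊓ B = B := by
    rw [← sup_inf_assoc_of_le _ inf_le_right, hs.eq_top, top_inf_eq]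
  obtain ⟨D, hCD, hDA⟩ := hC.symm.exists_isCompl
  have hAD := hDA.symm
  refine ⟨A.projection D hAD, fun v => ?_, fun v hv => ?_, fun v hv => ?_⟩
  · exact (A.projectionOnto D hAD v).2
  · simp [Submodule.projection, Submodule.projectionOnto_apply_of_mem_left hAD hv]
  · rw [← hB] at hv
    obtain ⟨a, ha, c, hc, rfl⟩ := Submodule.mem_sup.mp hv
    have h1 : A.projectionOnto D hAD c = 0 :=
      Submodule.projectionOnto_apply_of_mem_right hAD (hCD hc)
    simp only [Submodule.projection, LinearMap.comp_apply, map_add,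
      Submodule.projectionOnto_apply_of_mem_left hAD ha.1, h1, Submodule.subtype_apply,
      ZeroMemClass.coe_zero, add_zero]
    exact ha.2

end LinearAlgebra

/-! ### Generalized inverses and rank -/

section GeneralizedInverse

variable {F F' : Type*} [NormedAddCommGroup F] [NormedSpace ℝ F]
  [NormedAddCommGroup F'] [NormedSpace ℝ F'] [FiniteDimensional ℝ F']

/-- The rank of a continuous linear map. -/
abbrev clmRank (A : F →L[ℝ] F') : ℕ := Module.finrank ℝ (LinearMap.range (A : F →ₗ[ℝ] F'))

/-- If `t` extends a section of `A` over its range, then `A t A = A`; replacing `t` by `t A t` gives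
the second identity as well. -/
theorem exists_reflexive_inverse [FiniteDimensional ℝ F] (A : F →L[ℝ] F') :
    ∃ L : F' →L[ℝ] F, (∀ v, A (L (A v)) = A v) ∧ ∀ w, L (A (L w)) = L w := by
  obtain ⟨s, hs⟩ := (A : F →ₗ[ℝ] F').rangeRestrict.exists_rightInverse_of_surjective
    (LinearMap.range_rangeRestrict _)
  obtain ⟨t, ht⟩ := s.exists_extend
  have key : ∀ v, A (t (A v)) = A v := fun v => by
    have h1 : t (A v) = s ⟨A v, v, rfl⟩ := by
      rw [← ht]; rfl
    rw [h1]
    have := congrArg Subtype.val (LinearMap.congr_fun hs ⟨A v, v, rfl⟩)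
    simpa using this
  refine ⟨LinearMap.toContinuousLinearMap (t ∘ₗ A ∘ₗ t), fun v => ?_, fun w => ?_⟩
  · simp [key]
  · simp [key]

theorem clmRank_le_of_comp_comp_eq {A : F →L[ℝ] F'} {K : F' →L[ℝ] F}
    (h : ∀ v, A (K (A v)) = A v) : clmRank A ≤ clmRank K := by
  have : LinearMap.range (A : F →ₗ[ℝ] F') ≤
      (LinearMap.range (K : F' →ₗ[ℝ] F)).map (A : F →ₗ[ℝ] F') := by
    rintro _ ⟨v, rfl⟩
    exact ⟨K (A v), ⟨A v, rfl⟩, h v⟩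
  exact (Submodule.finrank_mono this).trans (Submodule.finrank_map_le _ _)

variable [FiniteDimensional ℝ F]

/-- `K A K = K` makes `A` injective on the range of `K`, so by the rank bound `A` maps that range
onto its own. Every `A v` is then some `A (K w)`, which `A K` fixes. -/
theorem comp_comp_eq_of_clmRank_le {A : F →L[ℝ] F'} {K : F' →L[ℝ] F}
    (h : ∀ w, K (A (K w)) = K w) (hr : clmRank A ≤ clmRank K) (v : F) : A (K (A v)) = A v := by
  have h1 : (LinearMap.range (K : F' →ₗ[ℝ] F)).map (A : F →ₗ[ℝ] F') =
      LinearMap.range (A : F →ₗ[ℝ] F') := by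
    apply Submodule.eq_of_le_of_finrank_le LinearMap.map_le_range
    refine hr.trans ?_
    have h2 : LinearMap.range (K : F' →ₗ[ℝ] F) ≤
        ((LinearMap.range (K : F' →ₗ[ℝ] F)).map (A : F →ₗ[ℝ] F')).map (K : F' →ₗ[ℝ] F) := by
      rintro _ ⟨w, rfl⟩
      exact ⟨A (K w), ⟨K w, ⟨w, rfl⟩, rfl⟩, h w⟩
    exact (Submodule.finrank_mono h2).trans (Submodule.finrank_map_le _ _)
  obtain ⟨_, ⟨w, rfl⟩, hw⟩ : A v ∈ (LinearMap.range (K : F' →ₗ[ℝ] F)).map (A : F →ₗ[ℝ] F') :=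
    h1 ▸ ⟨v, rfl⟩
  have hw' : A (K w) = A v := hw
  rw [← hw', h]

/-- A generalized inverse `κ A` of the linear maps `A` near `A₀`, of the same rank as `A₀` and
depending smoothly on `A`. -/
structure IsLocalGenInverse (A₀ : F →L[ℝ] F') (κ : (F →L[ℝ] F') → (F' →L[ℝ] F)) (A : F →L[ℝ] F') :
    Prop where
  contDiffAt : ContDiffAt ℝ ∞ κ A
  fderiv_apply : ∀ D, fderiv ℝ κ A D = -((κ A).comp (D.comp (κ A)))
  comp_comp : ∀ w, κ A (A (κ A w)) = κ A w
  rank_eq : clmRank (κ A) = clmRank A₀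

theorem exists_isLocalGenInverse (A₀ : F →L[ℝ] F') :
    ∃ κ : (F →L[ℝ] F') → (F' →L[ℝ] F), ∀ᶠ A in 𝓝 A₀, IsLocalGenInverse A₀ κ A := by
  obtain ⟨L, hL1, hL2⟩ := exists_reflexive_inverse A₀
  let u : (F →L[ℝ] F') → (F' →L[ℝ] F') := fun A => 1 + (A - A₀).comp L
  have hu : Continuous u := by fun_prop
  have hu0 : IsUnit (u A₀) := by simp [u]
  -- The formula `L (1 + (A - A₀) L)⁻¹` keeps the range of `L`, whence the fixed rank, and its
  -- derivative is `-κ D κ`.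
  refine ⟨fun A => L.comp (Ring.inverse (u A)), ?_⟩
  filter_upwards [hu.continuousAt.preimage_mem_nhds (Units.isOpen.mem_nhds hu0)] with A hA
  obtain ⟨U, hU⟩ : IsUnit (u A) := hA
  have hinv : Ring.inverse (u A) = ↑U⁻¹ := by rw [← hU, Ring.inverse_unit]
  have hUi : ∀ w, u A ((↑U⁻¹ : F' →L[ℝ] F') w) = w := fun w => by
    rw [← hU]; exact congrArg (fun T : F' →L[ℝ] F' => T w) U.mul_inv
  have hiU : ∀ w, (↑U⁻¹ : F' →L[ℝ] F') (u A w) = w := fun w => by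
    rw [← hU]; exact congrArg (fun T : F' →L[ℝ] F' => T w) U.inv_mul
  have huA : ∀ w, u A w = w + (A (L w) - A₀ (L w)) := fun w => by simp [u]
  have hud : HasFDerivAt u (ContinuousLinearMap.precomp F' L) A := by
    have h := ((ContinuousLinearMap.precomp F' L).hasFDerivAt (x := A - A₀)).comp A
      ((hasFDerivAt_id A).sub_const A₀)
    exact (h.const_add (1 : F' →L[ℝ] F')).congr_fderiv (by ext; simp)
  refine ⟨?_, fun D => ?_, fun w => ?_, ?_⟩
  · have h1 : ContDiffAt ℝ ∞ Ring.inverse (u A) := by rw [← hU]; exact contDiffAt_ringInverse ℝ U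
    have h2 : ContDiff ℝ ∞ u := by
      simp only [u]; fun_prop
    exact contDiffAt_const.clm_comp (h1.comp A h2.contDiffAt)
  · have h1 : HasFDerivAt Ring.inverse
        (-ContinuousLinearMap.mulLeftRight ℝ (F' →L[ℝ] F') ↑U⁻¹ ↑U⁻¹) (u A) := by
      rw [← hU]; exact hasFDerivAt_ringInverse (𝕜 := ℝ) U
    have h2 := ((ContinuousLinearMap.postcomp (σ := RingHom.id ℝ) F' L).hasFDerivAt
      (x := Ring.inverse (u A))).comp A (h1.comp A hud)
    have h3 := h2.fderiv
    change fderiv ℝ (fun A => L.comp (Ring.inverse (u A))) A = _ at h3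
    rw [h3, hinv]
    ext w
    exact map_neg L ((↑U⁻¹ : F' →L[ℝ] F') (D (L ((↑U⁻¹ : F' →L[ℝ] F') w))))
  · simp only [ContinuousLinearMap.comp_apply, hinv]
    set z := (↑U⁻¹ : F' →L[ℝ] F') w
    have hz : u A z = w := hUi w
    -- `L ∘ u A` equals `(1 + L (A - A₀)) ∘ L`, and the first factor is injective because `u A = 1 +
    -- (A - A₀) L` is.
    have key : ∀ y, L (u A y) = 0 → L y = 0 := fun y hy => by
      have h1 : L y + L (A (L y) - A₀ (L y)) = 0 := by rw [← map_add, ← huA]; exact hy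
      have h2 : u A (A (L y) - A₀ (L y)) = 0 := by
        rw [huA]
        have := congrArg (fun t => A t - A₀ t) h1
        simp only [map_add, map_zero] at this
        simpa only [sub_self, add_sub_add_comm] using this
      have h3 : A (L y) - A₀ (L y) = 0 := by rw [← hiU (A (L y) - A₀ (L y)), h2, map_zero]
      simpa [h3] using h1
    have h1 : u A (z - (↑U⁻¹ : F' →L[ℝ] F') (A (L z))) = z - A₀ (L z) := by
      rw [map_sub, hUi (A (L z)), huA z]; abel
    have h2 := key (z - (↑U⁻¹ : F' →L[ℝ] F') (A (L z))) (by rw [h1, map_sub, hL2, sub_self])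
    rw [map_sub, sub_eq_zero] at h2
    exact h2.symm
  · have h1 : LinearMap.range ((L.comp (Ring.inverse (u A)) : F' →L[ℝ] F) : F' →ₗ[ℝ] F) =
        LinearMap.range (L : F' →ₗ[ℝ] F) := by
      apply le_antisymm
      · rintro _ ⟨w, rfl⟩
        exact ⟨_, rfl⟩
      · rintro _ ⟨w, rfl⟩
        refine ⟨u A w, ?_⟩
        simp [hinv, hiU]
    rw [clmRank, h1]
    exact le_antisymm (clmRank_le_of_comp_comp_eq hL2) (clmRank_le_of_comp_comp_eq hL1)

end GeneralizedInverse

/-! ### Smooth families of linear maps and flags of kernels -/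

section SmoothNear

variable {E : Type*} [NormedAddCommGroup E] [NormedSpace ℝ E]
  {X : Type*} [TopologicalSpace X] [ChartedSpace E X]
  {F F' F'' : Type*} [NormedAddCommGroup F] [NormedSpace ℝ F]
  [NormedAddCommGroup F'] [NormedSpace ℝ F'] [NormedAddCommGroup F''] [NormedSpace ℝ F'']
  {x₀ : X}

/-- The vector valued function `f` is smooth at all points near `x₀`. -/
def SmoothNear (f : X → F) (x₀ : X) : Prop :=
  ∀ᶠ x in 𝓝 x₀, ContMDiffAt 𝓘(ℝ, E) 𝓘(ℝ, F) ∞ f x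

theorem smoothNear_const (c : F) : SmoothNear (E := E) (fun _ : X => c) x₀ :=
  Eventually.of_forall fun _ => contMDiffAt_const

theorem SmoothNear.add {f g : X → F} (hf : SmoothNear (E := E) f x₀)
    (hg : SmoothNear (E := E) g x₀) : SmoothNear (E := E) (fun x => f x + g x) x₀ := by
  filter_upwards [hf, hg] with x hx hx' using hx.add hx'

theorem SmoothNear.sub {f g : X → F} (hf : SmoothNear (E := E) f x₀)
    (hg : SmoothNear (E := E) g x₀) : SmoothNear (E := E) (fun x => f x - g x) x₀ := by
  filter_upwards [hf, hg] with x hx hx' using hx.sub hx'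

theorem SmoothNear.clm_comp {f : X → F' →L[ℝ] F''} {g : X → F →L[ℝ] F'}
    (hf : SmoothNear (E := E) f x₀) (hg : SmoothNear (E := E) g x₀) :
    SmoothNear (E := E) (fun x => (f x).comp (g x)) x₀ := by
  filter_upwards [hf, hg] with x hx hx' using hx.clm_comp hx'

theorem SmoothNear.continuousAt {f : X → F} (hf : SmoothNear (E := E) f x₀) :
    ContinuousAt f x₀ :=
  hf.self_of_nhds.continuousAt

theorem SmoothNear.comp_of_eventually {f : X → F} {κ : F → F'} (hf : SmoothNear (E := E) f x₀)
    (hκ : ∀ᶠ A in 𝓝 (f x₀), ContDiffAt ℝ ∞ κ A) : SmoothNear (E := E) (fun x => κ (f x)) x₀ := by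
  filter_upwards [hf, hf.continuousAt.eventually hκ] with x hx hx'
  exact hx'.contMDiffAt.comp x hx

variable [FiniteDimensional ℝ F] [FiniteDimensional ℝ F']

/-- A smooth family of linear maps of constant rank has, locally, a smooth family of maps onto its
kernels. -/
theorem exists_smoothNear_kernel_projection {A : X → F →L[ℝ] F'} (hA : SmoothNear (E := E) A x₀)
    (hr : ∀ᶠ x in 𝓝 x₀, clmRank (A x) = clmRank (A x₀)) :
    ∃ P : X → F →L[ℝ] F, SmoothNear (E := E) P x₀ ∧ (∀ᶠ x in 𝓝 x₀, ∀ v, A x (P x v) = 0) ∧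
      ∀ v, A x₀ v = 0 → P x₀ v = v := by
  obtain ⟨κ, hκ⟩ := exists_isLocalGenInverse (A x₀)
  -- `A (1 - κ A) = A - A κ A`, which vanishes near `x₀` because the rank is constant.
  refine ⟨fun x => ContinuousLinearMap.id ℝ F - (κ (A x)).comp (A x), ?_, ?_, fun v hv => ?_⟩
  · exact (smoothNear_const _).sub
      ((hA.comp_of_eventually (hκ.mono fun _ h => h.contDiffAt)).clm_comp hA)
  · filter_upwards [hA.continuousAt.eventually hκ, hr] with x hx hrx v
    have := comp_comp_eq_of_clmRank_le hx.comp_comp (by rw [hrx, hx.rank_eq]) v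
    simp [this]
  · simp [hv]

/-- The flag `N r` is treated one level at a time: `h` is kept on `N m x₀ ⊔ S`, and the new
directions of `N (m + 1) x₀` are moved by `P (m + 1)`, which lands in `N (m + 1) x`. -/
theorem exists_extension_preserving_chain (N : ℕ → X → Submodule ℝ F) (P : ℕ → X → F →L[ℝ] F)
    (hPs : ∀ r, SmoothNear (E := E) (P r) x₀) (hPN : ∀ r, ∀ᶠ x in 𝓝 x₀, ∀ v, P r x v ∈ N r x)
    (hP : ∀ r, ∀ v ∈ N r x₀, P r x₀ v = v) (hN0 : N 0 x₀ = ⊥)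
    (hN : ∀ r, ∀ᶠ x in 𝓝 x₀, N r x ≤ N (r + 1) x)
    (S : Submodule ℝ F) (h₀ : X → F →L[ℝ] F) (h₀s : SmoothNear (E := E) h₀ x₀)
    (h₀S : ∀ v ∈ S, h₀ x₀ v = v)
    (h₀N : ∀ r, ∀ᶠ x in 𝓝 x₀, ∀ v ∈ S, v ∈ N r x₀ → h₀ x v ∈ N r x) (m : ℕ) :
    ∃ h : X → F →L[ℝ] F, SmoothNear (E := E) h x₀ ∧ (∀ x, ∀ v ∈ S, h x v = h₀ x v) ∧
      (∀ v ∈ N m x₀ ⊔ S, h x₀ v = v) ∧ ∀ r ≤ m, ∀ᶠ x in 𝓝 x₀, ∀ v ∈ N r x₀, h x v ∈ N r x := by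
  have hmono : Monotone fun r => N r x₀ := monotone_nat_of_le_succ fun r => (hN r).self_of_nhds
  induction m with
  | zero =>
    refine ⟨h₀, h₀s, fun _ _ _ => rfl, by simpa [hN0] using h₀S, fun r hr => ?_⟩
    obtain rfl : r = 0 := by omega
    refine Eventually.of_forall fun x v hv => ?_
    rw [hN0, Submodule.mem_bot] at hv
    simp [hv]
  | succ m ih =>
    obtain ⟨h, hs, hS, hid, hNr⟩ := ih
    obtain ⟨q', hqA, hqid, hqB⟩ := exists_projection_preserving (N m x₀ ⊔ S) (N (m + 1) x₀)
    let q : F →L[ℝ] F := LinearMap.toContinuousLinearMap q'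
    have hq : ∀ v, q v = q' v := fun v => rfl
    refine ⟨fun x => (h x).comp q + (P (m + 1) x).comp (ContinuousLinearMap.id ℝ F - q),
      (hs.clm_comp (smoothNear_const q)).add ((hPs (m + 1)).clm_comp (smoothNear_const _)),
      fun x v hv => ?_, fun v hv => ?_, fun r hr => ?_⟩
    · have : q v = v := hqid v (Submodule.mem_sup_right hv)
      simp [this, hS x v hv]
    · obtain ⟨b, hb, s, hs', rfl⟩ := Submodule.mem_sup.mp hv
      have h1 : q s = s := hqid s (Submodule.mem_sup_right hs')
      have h2 : h x₀ (q b) = q b := hid _ (hqA b)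
      have h3 : h x₀ s = s := hid _ (Submodule.mem_sup_right hs')
      have h4 : P (m + 1) x₀ (b - q b) = b - q b :=
        hP _ _ (Submodule.sub_mem _ hb (hqB b hb))
      simp only [add_apply, ContinuousLinearMap.comp_apply,
        sub_apply, ContinuousLinearMap.id_apply, map_add, h1, h2, h3,
        sub_self, map_zero, add_zero, h4]
      abel
    · rcases Nat.lt_or_ge m r with hmr | hmr
      · obtain rfl : r = m + 1 := by omega
        filter_upwards [hNr m le_rfl, hN m, hPN (m + 1), h₀N (m + 1)] with x h1 h2 h3 h4 v hv
        refine Submodule.add_mem _ ?_ (h3 _)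
        -- Because `q` preserves `N (m + 1) x₀`, the component `s` in `S` lies in it too, so the
        -- hypothesis on `h₀` applies.
        obtain ⟨a, ha, s, hs', has⟩ := Submodule.mem_sup.mp (hqA v)
        have hsB : s ∈ N (m + 1) x₀ := by
          rw [← add_sub_cancel_left a s, has]
          exact Submodule.sub_mem _ (hqB v hv) (hmono (Nat.le_succ m) ha)
        have : h x (q v) = h x a + h₀ x s := by rw [hq, ← has, map_add, hS x s hs']
        change h x (q v) ∈ _
        rw [this]
        exact Submodule.add_mem _ (h2 (h1 a ha)) (h4 s hs' hsB)
      · filter_upwards [hNr r hmr] with x h1 v hv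
        have : q v = v := hqid v (Submodule.mem_sup_left (hmono hmr hv))
        simpa [this] using h1 v hv

end SmoothNear

/-! ### Flat connections attached to frames -/

section FrameCov

variable {E : Type*} [NormedAddCommGroup E] [NormedSpace ℝ E]
  {X : Type*} [TopologicalSpace X] [ChartedSpace E X]
  {F : Type*} [NormedAddCommGroup F] [NormedSpace ℝ F]
  {V : X → Type*} [TopologicalSpace (TotalSpace F V)] [∀ x, AddCommGroup (V x)]
  [∀ x, Module ℝ (V x)] [∀ x, TopologicalSpace (V x)] [FiberBundle F V] [VectorBundle ℝ F V]
  (e : Trivialization F (TotalSpace.proj : TotalSpace F V → X)) [MemTrivializationAtlas e]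
  (H : X → F →L[ℝ] F)

/-- The section `σ` read in the trivialization `e` twisted by the endomorphisms `H`. -/
def frameCoord (σ : ∀ x, V x) (x : X) : F := H x (e.continuousLinearMapAt ℝ x (σ x))

/-- The flat connection whose parallel sections are those with constant coordinates in the
trivialization `e` twisted by the endomorphisms `H`. -/
def frameCov (σ : ∀ x, V x) (x : X) : TangentSpace 𝓘(ℝ, E) x →L[ℝ] V x :=
  (e.symmL ℝ x).comp ((Ring.inverse (H x)).comp (mvfderiv 𝓘(ℝ, E) (frameCoord e H σ) x))

variable {e H} {x : X}

theorem frameCoord_contMDiffAt {n : ℕ∞ω} [ContMDiffVectorBundle n F V 𝓘(ℝ, E)] (hx : x ∈ e.baseSet)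
    (hH : ContMDiffAt 𝓘(ℝ, E) 𝓘(ℝ, F →L[ℝ] F) n H x) {σ : ∀ x, V x}
    (hσ : ContMDiffAt 𝓘(ℝ, E) (𝓘(ℝ, E).prod 𝓘(ℝ, F)) n (fun y => TotalSpace.mk' F y (σ y)) x) :
    ContMDiffAt 𝓘(ℝ, E) 𝓘(ℝ, F) n (frameCoord e H σ) x := by
  refine hH.clm_apply (((e.contMDiffAt_section_iff hx).mp hσ).congr_of_eventuallyEq ?_)
  filter_upwards [e.open_baseSet.mem_nhds hx] with y hy
  simp [e.coe_linearMapAt_of_mem hy]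

theorem frameCoord_mdifferentiableAt [ContMDiffVectorBundle 1 F V 𝓘(ℝ, E)] (hx : x ∈ e.baseSet)
    (hH : MDifferentiableAt 𝓘(ℝ, E) 𝓘(ℝ, F →L[ℝ] F) H x) {σ : ∀ x, V x}
    (hσ : MDifferentiableAt 𝓘(ℝ, E) (𝓘(ℝ, E).prod 𝓘(ℝ, F)) (fun y => TotalSpace.mk' F y (σ y)) x) :
    MDifferentiableAt 𝓘(ℝ, E) 𝓘(ℝ, F) (frameCoord e H σ) x := by
  refine hH.clm_apply (((e.mdifferentiableAt_section_iff _ _ hx).mp hσ).congr_of_eventuallyEq ?_)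
  filter_upwards [e.open_baseSet.mem_nhds hx] with y hy
  simp [e.coe_linearMapAt_of_mem hy]

/-- Smoothness of a family of linear maps between the fibres of vector bundles can be read in any
trivializations. -/
theorem contMDiffAt_hom_iff {F' : Type*} [NormedAddCommGroup F'] [NormedSpace ℝ F']
    {V' : X → Type*} [TopologicalSpace (TotalSpace F' V')] [∀ x, AddCommGroup (V' x)]
    [∀ x, Module ℝ (V' x)] [∀ x, TopologicalSpace (V' x)] [FiberBundle F' V']
    [VectorBundle ℝ F' V'] [∀ x, IsTopologicalAddGroup (V' x)] [∀ x, ContinuousSMul ℝ (V' x)]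
    {n : ℕ∞ω} [ContMDiffVectorBundle n F V 𝓘(ℝ, E)] [ContMDiffVectorBundle n F' V' 𝓘(ℝ, E)]
    {e' : Trivialization F' (TotalSpace.proj : TotalSpace F' V' → X)} [MemTrivializationAtlas e']
    (hx : x ∈ e.baseSet) (hx' : x ∈ e'.baseSet) {f : ∀ x, V x →L[ℝ] V' x} :
    ContMDiffAt 𝓘(ℝ, E) (𝓘(ℝ, E).prod 𝓘(ℝ, F →L[ℝ] F')) n
      (fun x => (TotalSpace.mk' (F →L[ℝ] F') x (f x) :
        TotalSpace (F →L[ℝ] F') (fun x => V x →L[ℝ] V' x))) x ↔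
    ContMDiffAt 𝓘(ℝ, E) 𝓘(ℝ, F →L[ℝ] F') n
      (fun x => (e'.continuousLinearMapAt ℝ x).comp ((f x).comp (e.symmL ℝ x))) x :=
  (e.continuousLinearMap (RingHom.id ℝ) e').contMDiffAt_section_iff (n := n) (s := f) ⟨hx, hx'⟩

variable [∀ x, IsTopologicalAddGroup (V x)] [∀ x, ContinuousSMul ℝ (V x)]

/-- Over `U` the twisted coordinates identify the bundle with the trivial one, and the operator is
the ordinary derivative transported back. -/
theorem frameCov_isCovariantDerivativeOn [ContMDiffVectorBundle 1 F V 𝓘(ℝ, E)] {U : Set X}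
    (hU : U ⊆ e.baseSet) (hH : ∀ x ∈ U, MDifferentiableAt 𝓘(ℝ, E) 𝓘(ℝ, F →L[ℝ] F) H x)
    (hHu : ∀ x ∈ U, IsUnit (H x)) :
    IsCovariantDerivativeOn F (I := 𝓘(ℝ, E)) (frameCov (V := V) e H) U where
  add {σ σ' x} hσ hσ' hx := by
    have h1 : frameCoord e H (σ + σ') = frameCoord e H σ + frameCoord e H σ' := by
      ext y; simp [frameCoord]
    simp only [frameCov]
    rw [h1, mvfderiv_add (frameCoord_mdifferentiableAt (hU hx) (hH x hx) hσ)
      (frameCoord_mdifferentiableAt (hU hx) (hH x hx) hσ')]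
    ext v
    simp
  leibniz {σ g x} hσ hg hx := by
    have h1 : frameCoord e H (g • σ) = g • frameCoord e H σ := by
      ext y; simp [frameCoord]
    simp only [frameCov]
    rw [h1, mvfderiv_smul hg (frameCoord_mdifferentiableAt (hU hx) (hH x hx) hσ)]
    ext v
    have h2 : ∀ w, Ring.inverse (H x) (H x w) = w := fun w =>
      congrArg (fun T : F →L[ℝ] F => T w) (Ring.inverse_mul_cancel _ (hHu x hx))
    have h3 := e.symmL_continuousLinearMapAt (R := ℝ) (hU hx) (σ x)
    simp only [Trivialization.continuousLinearMapAt_apply] at h3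
    simp [frameCoord, h2, h3]

theorem mvfderiv_tangentCoord_contMDiffAt [IsManifold 𝓘(ℝ, E) ∞ X] {g : X → F}
    (hg : ContMDiffAt 𝓘(ℝ, E) 𝓘(ℝ, F) ∞ g x) :
    ContMDiffAt 𝓘(ℝ, E) 𝓘(ℝ, E →L[ℝ] F) ∞
      (fun y => (mvfderiv 𝓘(ℝ, E) g y).comp
        ((trivializationAt E (TangentSpace 𝓘(ℝ, E)) x).symmL ℝ y)) x := by
  have h := hg.mfderiv_const (m := ∞) (by simp)
  refine h.congr_of_eventuallyEq ?_
  refine Eventually.of_forall fun y => ?_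
  simp only [inTangentCoordinates, ContinuousLinearMap.inCoordinates]
  rw [TangentBundle.continuousLinearMapAt_model_space]
  rfl

theorem frameCov_contMDiffCovariantDerivativeOn [IsManifold 𝓘(ℝ, E) ∞ X] [CompleteSpace F]
    [ContMDiffVectorBundle ∞ F V 𝓘(ℝ, E)] {U : Set X} (hUo : IsOpen U)
    (hU : U ⊆ e.baseSet) (hH : ∀ x ∈ U, ContMDiffAt 𝓘(ℝ, E) 𝓘(ℝ, F →L[ℝ] F) ∞ H x)
    (hHu : ∀ x ∈ U, IsUnit (H x)) :
    ContMDiffCovariantDerivativeOn F (I := 𝓘(ℝ, E)) ∞ (frameCov (V := V) e H) U where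
  contMDiff {σ} hσ := by
    intro x hx
    have hσx := (hσ.contMDiffAt (hUo.mem_nhds hx)).of_le (le_self_add : (∞ : ℕ∞ω) ≤ ∞ + 1)
    have h1 := mvfderiv_tangentCoord_contMDiffAt
      (frameCoord_contMDiffAt (hU hx) (hH x hx) hσx)
    have h2 : ContMDiffAt 𝓘(ℝ, E) 𝓘(ℝ, F →L[ℝ] F) ∞ (fun y => Ring.inverse (H y)) x := by
      obtain ⟨u, hu⟩ := hHu x hx
      have : ContDiffAt ℝ ∞ Ring.inverse (H x) := hu ▸ contDiffAt_ringInverse ℝ u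
      exact this.contMDiffAt.comp x (hH x hx)
    refine ContMDiffAt.contMDiffWithinAt ?_
    rw [contMDiffAt_hom_iff (e := trivializationAt E (TangentSpace 𝓘(ℝ, E)) x) (e' := e)
      (FiberBundle.mem_baseSet_trivializationAt' x) (hU hx)]
    refine (h2.clm_comp h1).congr_of_eventuallyEq ?_
    filter_upwards [hUo.mem_nhds hx] with y hy
    ext v
    simp [frameCov, e.continuousLinearMapAt_symmL (hU hy)]

end FrameCov

/-! ### Rank under `df = f a - b f` -/

section RankTransport

variable {E : Type*} [NormedAddCommGroup E] [NormedSpace ℝ E]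
  {F F' : Type*} [NormedAddCommGroup F] [NormedSpace ℝ F]
  [NormedAddCommGroup F'] [NormedSpace ℝ F']

/-- With `dκ = -κ (df) κ`, the defect `S = f - f κ f` has derivative `(1 - f κ) f' (1 - κ f)`.
Substituting `f' = f α - β f` and using `f (1 - κ f) = (1 - f κ) f = S` makes it linear in `S`. -/
theorem hasDerivAt_sub_comp_genInverse_comp {A₀ : F →L[ℝ] F'} {κ : (F →L[ℝ] F') → (F' →L[ℝ] F)}
    {f : ℝ → F →L[ℝ] F'} {t : ℝ} (hκ : IsLocalGenInverse A₀ κ (f t)) {α : F →L[ℝ] F}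
    {β : F' →L[ℝ] F'} (hf : HasDerivAt f ((f t).comp α - β.comp (f t)) t) :
    HasDerivAt (fun s => f s - (f s).comp ((κ (f s)).comp (f s)))
      ((f t - (f t).comp ((κ (f t)).comp (f t))).comp
          (α.comp (ContinuousLinearMap.id ℝ F - (κ (f t)).comp (f t))) -
        (ContinuousLinearMap.id ℝ F' - (f t).comp (κ (f t))).comp
          (β.comp (f t - (f t).comp ((κ (f t)).comp (f t))))) t := by
  have hk : HasDerivAt (fun s => κ (f s)) (fderiv ℝ κ (f t) ((f t).comp α - β.comp (f t))) t :=
    (hκ.contDiffAt.differentiableAt (by simp)).hasFDerivAt.comp_hasDerivAt t hf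
  rw [hκ.fderiv_apply] at hk
  refine (hf.sub (hf.clm_comp (hk.clm_comp hf))).congr_deriv ?_
  ext w
  simp only [sub_apply, add_apply, neg_apply, ContinuousLinearMap.comp_apply,
    ContinuousLinearMap.id_apply, map_sub, map_neg, map_add]
  abel

theorem eventually_norm_le_of_continuousAt {X G : Type*} [TopologicalSpace X]
    [NormedAddCommGroup G] {g : X → G} {x : X} (hg : ContinuousAt g x) :
    ∃ C, 0 ≤ C ∧ ∀ᶠ y in 𝓝 x, ‖g y‖ ≤ C :=
  ⟨‖g x‖ + 1, by positivity, (hg.norm.eventually_lt_const (lt_add_one _)).mono fun _ h => h.le⟩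

theorem eventually_apply_norm_le_of_continuousAt {X G G' : Type*} [TopologicalSpace X]
    [NormedAddCommGroup G] [NormedSpace ℝ G] [NormedAddCommGroup G'] [NormedSpace ℝ G']
    {g : X → G →L[ℝ] G'} {x : X} (hg : ContinuousAt g x) :
    ∃ C, 0 ≤ C ∧ ∀ᶠ y in 𝓝 x, ∀ v, ‖g y v‖ ≤ C * ‖v‖ := by
  obtain ⟨C, hC, h⟩ := eventually_norm_le_of_continuousAt hg
  exact ⟨C, hC, h.mono fun y hy v => (g y).le_of_opNorm_le hy v⟩

/-- A family of linear maps satisfying `df = f a - b f` with locally bounded `a` and `b` has locally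
constant rank. -/
theorem eventually_clmRank_eq_of_hasFDerivAt [FiniteDimensional ℝ F]
    [FiniteDimensional ℝ F'] {f : E → F →L[ℝ] F'} {f' : E → E →L[ℝ] F →L[ℝ] F'}
    {a : E → E →L[ℝ] F →L[ℝ] F} {b : E → E →L[ℝ] F' →L[ℝ] F'} {u₀ : E}
    (ha : ContinuousAt a u₀) (hb : ContinuousAt b u₀)
    (hf : ∀ᶠ u in 𝓝 u₀, HasFDerivAt f (f' u) u)
    (hf' : ∀ᶠ u in 𝓝 u₀, ∀ v, f' u v = (f u).comp (a u v) - (b u v).comp (f u)) :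
    ∀ᶠ u in 𝓝 u₀, clmRank (f u) = clmRank (f u₀) := by
  obtain ⟨κ, hκ⟩ := exists_isLocalGenInverse (f u₀)
  have hfc : ContinuousAt f u₀ := hf.self_of_nhds.continuousAt
  have hkc : ContinuousAt (fun u => κ (f u)) u₀ :=
    ContinuousAt.comp (f := f) hκ.self_of_nhds.contDiffAt.continuousAt hfc
  obtain ⟨Ca, hCa, ha'⟩ := eventually_apply_norm_le_of_continuousAt ha
  obtain ⟨Cb, hCb, hb'⟩ := eventually_apply_norm_le_of_continuousAt hb
  obtain ⟨Cp, hCp, hp'⟩ := eventually_norm_le_of_continuousAt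
    (g := fun u => ContinuousLinearMap.id ℝ F - (κ (f u)).comp (f u))
    (continuousAt_const.sub (hkc.clm_comp hfc))
  obtain ⟨Cq, hCq, hq'⟩ := eventually_norm_le_of_continuousAt
    (g := fun u => ContinuousLinearMap.id ℝ F' - (f u).comp (κ (f u)))
    (continuousAt_const.sub (hfc.clm_comp hkc))
  obtain ⟨ε, hε, hball⟩ := Metric.eventually_nhds_iff_ball.mp
    ((hf.and hf').and ((ha'.and hb').and ((hp'.and hq').and (hfc.eventually hκ))))
  filter_upwards [Metric.ball_mem_nhds u₀ hε] with u hu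
  set γ : ℝ → E := fun t => u₀ + t • (u - u₀)
  have hγ : ∀ t ∈ Set.Icc (0 : ℝ) 1, γ t ∈ Metric.ball u₀ ε := fun t ht => by
    rw [Metric.mem_ball, dist_eq_norm] at hu ⊢
    simp only [γ, add_sub_cancel_left, norm_smul, Real.norm_eq_abs, abs_of_nonneg ht.1]
    exact (mul_le_of_le_one_left (norm_nonneg _) ht.2).trans_lt hu
  have hγd : ∀ t, HasDerivAt γ (u - u₀) t := fun t => by
    simpa [γ] using ((hasDerivAt_id t).smul_const (u - u₀)).const_add u₀
  set S : ℝ → F →L[ℝ] F' :=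
    fun t => f (γ t) - (f (γ t)).comp ((κ (f (γ t))).comp (f (γ t))) with hS
  have hSd : ∀ t ∈ Set.Icc (0 : ℝ) 1, HasDerivAt S
      ((S t).comp ((a (γ t) (u - u₀)).comp
          (ContinuousLinearMap.id ℝ F - (κ (f (γ t))).comp (f (γ t)))) -
        (ContinuousLinearMap.id ℝ F' - (f (γ t)).comp (κ (f (γ t)))).comp
          ((b (γ t) (u - u₀)).comp (S t))) t := fun t ht => by
    obtain ⟨⟨h1, h2⟩, -, -, h3⟩ := hball _ (hγ t ht)
    have h4 := h1.comp_hasDerivAt t (hγd t)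
    rw [h2] at h4
    exact hasDerivAt_sub_comp_genInverse_comp (f := fun t => f (γ t)) h3 h4
  have hγ0 : γ 0 = u₀ := by simp [γ]
  have hγ1 : γ 1 = u := by simp [γ]
  have hS0 : S 0 = 0 := by
    ext w
    have := comp_comp_eq_of_clmRank_le hκ.self_of_nhds.comp_comp hκ.self_of_nhds.rank_eq.ge w
    simp [hS, hγ0, this]
  -- Grönwall on `[0, 1]`: the two summands of `K` bound the two terms of the derivative of `S`.
  have hS1 := eq_zero_of_abs_deriv_le_mul_abs_self_of_eq_zero_right
    (K := Ca * ‖u - u₀‖ * Cp + Cq * (Cb * ‖u - u₀‖)) (a := 0) (b := 1)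
    (fun t ht => (hSd t ht).continuousAt.continuousWithinAt)
    (fun t ht => (hSd t ⟨ht.1, ht.2.le⟩).hasDerivWithinAt) hS0 (fun t ht => ?_) 1 (by simp)
  · obtain ⟨-, -, -, h3⟩ := hball _ hu
    have h4 : ∀ w, f u (κ (f u) (f u w)) = f u w := fun w => by
      have := congrArg (fun T : F →L[ℝ] F' => T w) hS1
      simp only [hS, hγ1] at this
      exact (sub_eq_zero.mp this).symm
    exact ((clmRank_le_of_comp_comp_eq h4).trans_eq h3.rank_eq).antisymm
      (h3.rank_eq.symm.trans_le (clmRank_le_of_comp_comp_eq h3.comp_comp))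
  · obtain ⟨-, ⟨h1, h2⟩, ⟨h3, h4⟩, -⟩ := hball _ (hγ t ⟨ht.1, ht.2.le⟩)
    have h5 : ‖a (γ t) (u - u₀)‖ ≤ Ca * ‖u - u₀‖ := h1 _
    have h6 : ‖b (γ t) (u - u₀)‖ ≤ Cb * ‖u - u₀‖ := h2 _
    refine (norm_sub_le _ _).trans ?_
    rw [add_mul]
    refine add_le_add ?_ ?_
    · refine (ContinuousLinearMap.opNorm_comp_le _ _).trans ?_
      rw [mul_comm]
      refine mul_le_mul_of_nonneg_right ?_ (norm_nonneg _)
      exact (ContinuousLinearMap.opNorm_comp_le _ _).trans (by gcongr)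
    · refine (ContinuousLinearMap.opNorm_comp_le _ _).trans ?_
      rw [mul_assoc]
      refine mul_le_mul h4 ?_ (norm_nonneg _) hCq
      exact (ContinuousLinearMap.opNorm_comp_le _ _).trans (by gcongr)

end RankTransport

/-! ### Connection forms in a trivialization -/

section ConnectionForm

variable {E : Type*} [NormedAddCommGroup E] [NormedSpace ℝ E]
  {X : Type*} [TopologicalSpace X] [ChartedSpace E X]
  {F : Type*} [NormedAddCommGroup F] [NormedSpace ℝ F]
  {V : X → Type*} [TopologicalSpace (TotalSpace F V)] [∀ x, AddCommGroup (V x)]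
  [∀ x, Module ℝ (V x)] [∀ x, TopologicalSpace (V x)] [FiberBundle F V] [VectorBundle ℝ F V]
  (e : Trivialization F (TotalSpace.proj : TotalSpace F V → X)) [MemTrivializationAtlas e]

theorem contMDiffOn_symmL_const [ContMDiffVectorBundle ∞ F V 𝓘(ℝ, E)] (w : F) :
    ContMDiffOn 𝓘(ℝ, E) (𝓘(ℝ, E).prod 𝓘(ℝ, F)) ∞
      (fun x => TotalSpace.mk' F x (e.symmL ℝ x w)) e.baseSet := by
  rw [e.contMDiffOn_section_baseSet_iff]
  refine (contMDiffOn_const (c := w)).congr fun x hx => ?_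
  have := e.continuousLinearMapAt_symmL (R := ℝ) hx w
  simpa [e.coe_linearMapAt_of_mem hx] using this

theorem exists_contMDiff_section_eq_symmL [FiniteDimensional ℝ E] [T2Space X]
    [IsManifold 𝓘(ℝ, E) ∞ X] [ContMDiffVectorBundle ∞ F V 𝓘(ℝ, E)] {x₀ : X} (hx₀ : x₀ ∈ e.baseSet)
    (w : F) :
    ∃ σ : ∀ x, V x, ContMDiff 𝓘(ℝ, E) (𝓘(ℝ, E).prod 𝓘(ℝ, F)) ∞
      (fun x => TotalSpace.mk' F x (σ x)) ∧ ∀ᶠ x in 𝓝 x₀, σ x = e.symmL ℝ x w := by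
  obtain ⟨f, -, hf⟩ := (SmoothBumpFunction.nhds_basis_tsupport (I := 𝓘(ℝ, E)) x₀).mem_iff.mp
    (e.open_baseSet.mem_nhds hx₀)
  refine ⟨(f : X → ℝ) • fun x => e.symmL ℝ x w,
    ContMDiffOn.smul_section_of_tsupport f.contMDiff.contMDiffOn e.open_baseSet hf
      (contMDiffOn_symmL_const e w), ?_⟩
  filter_upwards [f.eventuallyEq_one] with x hx
  simp [hx]

variable [∀ x, IsTopologicalAddGroup (V x)] [∀ x, ContinuousSMul ℝ (V x)]

/-- The connection form of a smooth connection in a trivialization is continuous. -/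
theorem exists_connectionForm [FiniteDimensional ℝ E] [T2Space X] [IsManifold 𝓘(ℝ, E) ∞ X]
    [FiniteDimensional ℝ F] [ContMDiffVectorBundle ∞ F V 𝓘(ℝ, E)]
    (cov : CovariantDerivative 𝓘(ℝ, E) F V)
    (hcov : CovariantDerivative.ContMDiffCovariantDerivative cov ∞) {x₀ : X}
    (hx₀ : x₀ ∈ e.baseSet) :
    ∃ Γ : X → E →L[ℝ] F →L[ℝ] F, ContinuousAt Γ x₀ ∧ ∀ x ∈ e.baseSet, ∀ σ : ∀ x, V x,
      MDifferentiableAt 𝓘(ℝ, E) (𝓘(ℝ, E).prod 𝓘(ℝ, F)) (fun y => TotalSpace.mk' F y (σ y)) x →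
      ∀ v, e.continuousLinearMapAt ℝ x
          (cov σ x ((trivializationAt E (TangentSpace 𝓘(ℝ, E)) x₀).symmL ℝ x v)) =
        mvfderiv 𝓘(ℝ, E) (frameCoord e (fun _ => 1) σ) x
          ((trivializationAt E (TangentSpace 𝓘(ℝ, E)) x₀).symmL ℝ x v) +
        Γ x v (e.continuousLinearMapAt ℝ x (σ x)) := by
  have : ContMDiffVectorBundle 1 F V 𝓘(ℝ, E) := ContMDiffVectorBundle.of_le (n := ∞) (by simp)
  have hflat := frameCov_isCovariantDerivativeOn (E := E) (V := V) (e := e) (H := fun _ => 1)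
    subset_rfl (fun x _ => mdifferentiableAt_const) (fun x _ => isUnit_one)
  let τ := fun x => (trivializationAt E (TangentSpace 𝓘(ℝ, E)) x₀).symmL ℝ x
  -- The difference from the flat connection of `e` is tensorial; `Γ` is this tensor in coordinates.
  let diff := (cov.isCovariantDerivativeOn (s := e.baseSet)).difference hflat
  let Γ : X → E →L[ℝ] F →L[ℝ] F := fun x => LinearMap.toContinuousLinearMap
    ((LinearMap.toContinuousLinearMap : (F →ₗ[ℝ] F) ≃ₗ[ℝ] (F →L[ℝ] F)).toLinearMap ∘ₗ
      LinearMap.mk₂ ℝ (fun v w => e.continuousLinearMapAt ℝ x (diff x (e.symmL ℝ x w) (τ x v)))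
        (by intros; simp only [map_add]) (by intros; simp only [map_smul])
        (by intros; simp only [map_add, add_apply])
        (by intros; simp only [map_smul, smul_apply]))
  have hΓ : ∀ x v w, Γ x v w = e.continuousLinearMapAt ℝ x (diff x (e.symmL ℝ x w) (τ x v)) :=
    fun _ _ _ => rfl
  have key : ∀ x ∈ e.baseSet, ∀ σ : ∀ x, V x,
      MDifferentiableAt 𝓘(ℝ, E) (𝓘(ℝ, E).prod 𝓘(ℝ, F)) (fun y => TotalSpace.mk' F y (σ y)) x →
      ∀ v, e.continuousLinearMapAt ℝ x (cov σ x (τ x v)) =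
        mvfderiv 𝓘(ℝ, E) (frameCoord e (fun _ => 1) σ) x (τ x v) +
        Γ x v (e.continuousLinearMapAt ℝ x (σ x)) := by
    intro x hx σ hσ v
    have h1 := IsCovariantDerivativeOn.difference_apply
      (cov.isCovariantDerivativeOn (s := e.baseSet)) hflat hx hσ
    have h2 := e.continuousLinearMapAt_symmL (R := ℝ) hx
    rw [hΓ, e.symmL_continuousLinearMapAt hx, h1, sub_apply, map_sub]
    simp only [frameCov, ContinuousLinearMap.comp_apply, Ring.inverse_one, h2,
      one_apply_eq_self]
    abel
  refine ⟨Γ, ?_, key⟩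
  rw [continuousAt_clm_apply]
  intro v
  rw [continuousAt_clm_apply]
  intro w
  -- Smoothness of `cov` is tested on global sections, so the frame section is cut off by a bump
  -- function. Near `x₀` its flat derivative vanishes, leaving `Γ x v w`.
  obtain ⟨σ, hσ, hσe⟩ := exists_contMDiff_section_eq_symmL (E := E) e hx₀ w
  have h1 := hcov.contMDiff.contMDiff (σ := σ) (by simpa using hσ.contMDiffOn)
  have h2 := (contMDiffAt_hom_iff (e := trivializationAt E (TangentSpace 𝓘(ℝ, E)) x₀) (e' := e)
      (FiberBundle.mem_baseSet_trivializationAt' x₀) hx₀).mp (h1.contMDiffAt univ_mem)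
  have h3 := (h2.continuousAt.clm_apply (continuousAt_const (y := v)))
  refine h3.congr ?_
  filter_upwards [hσe.eventually_nhds, e.open_baseSet.mem_nhds hx₀] with x hx hxe
  have h4 := key x hxe σ ((hσ x).mdifferentiableAt (by simp)) v
  have h5 : frameCoord e (fun _ => 1) σ =ᶠ[𝓝 x] fun _ => w := by
    filter_upwards [hx, e.open_baseSet.mem_nhds hxe] with y hy hye
    simpa [frameCoord, hy] using e.continuousLinearMapAt_symmL (R := ℝ) hye w
  have h6 : mvfderiv 𝓘(ℝ, E) (frameCoord e (fun _ => 1) σ) x = 0 := by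
    rw [mvfderiv, h5.mfderiv_eq]
    exact mvfderiv_const w
  rw [h6, hx.self_of_nhds, e.continuousLinearMapAt_symmL hxe] at h4
  simpa using h4

end ConnectionForm

theorem mvfderiv_clm_apply {E : Type*} [NormedAddCommGroup E] [NormedSpace ℝ E]
    {X : Type*} [TopologicalSpace X] [ChartedSpace E X] {F F' : Type*} [NormedAddCommGroup F]
    [NormedSpace ℝ F] [NormedAddCommGroup F'] [NormedSpace ℝ F'] (L : F →L[ℝ] F') {g : X → F}
    {x : X} (hg : MDifferentiableAt 𝓘(ℝ, E) 𝓘(ℝ, F) g x) :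
    mvfderiv 𝓘(ℝ, E) (fun y => L (g y)) x = L.comp (mvfderiv 𝓘(ℝ, E) g x) :=
  (L.hasMFDerivAt.comp x hg.hasMFDerivAt).mfderiv

/-! ### Compatible morphisms have locally constant rank -/

section ConstantRank

variable {E : Type*} [NormedAddCommGroup E] [NormedSpace ℝ E]
  {X : Type*} [TopologicalSpace X] [ChartedSpace E X]
  {A B C : SmoothVectorBundle.{u, v} E X}

/-- A family of linear maps between the fibres, read in trivializations. -/
def homCoord (e : Trivialization A.F (TotalSpace.proj : TotalSpace A.F A.V → X))
    [MemTrivializationAtlas e] (e' : Trivialization B.F (TotalSpace.proj : TotalSpace B.F B.V → X))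
    [MemTrivializationAtlas e'] (f : ∀ x, A.V x →L[ℝ] B.V x) (x : X) : A.F →L[ℝ] B.F :=
  (e'.continuousLinearMapAt ℝ x).comp ((f x).comp (e.symmL ℝ x))

variable {e : Trivialization A.F (TotalSpace.proj : TotalSpace A.F A.V → X)}
    [MemTrivializationAtlas e] {e' : Trivialization B.F (TotalSpace.proj : TotalSpace B.F B.V → X)}
    [MemTrivializationAtlas e'] {f : ∀ x, A.V x →L[ℝ] B.V x} {x : X}

theorem clmRank_homCoord (hx : x ∈ e.baseSet) (hx' : x ∈ e'.baseSet) :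
    clmRank (homCoord e e' f x) =
      Module.finrank ℝ (LinearMap.range (f x : A.V x →ₗ[ℝ] B.V x)) := by
  have h1 : (homCoord e e' f x : A.F →ₗ[ℝ] B.F) =
      (e'.continuousLinearEquivAt ℝ x hx').toLinearEquiv.toLinearMap ∘ₗ
        (f x : A.V x →ₗ[ℝ] B.V x) ∘ₗ
          (e.continuousLinearEquivAt ℝ x hx).symm.toLinearEquiv.toLinearMap := by
    ext w
    simp [homCoord, e.symmL_apply hx, e'.coe_linearMapAt_of_mem hx']
  rw [clmRank, h1, LinearMap.range_comp, LinearMap.range_comp_of_range_eq_top]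
  · exact LinearEquiv.finrank_map_eq _ _
  · exact LinearEquiv.range _

theorem contMDiffAt_homCoord_iff (hx : x ∈ e.baseSet) (hx' : x ∈ e'.baseSet) :
    ContMDiffAt 𝓘(ℝ, E) 𝓘(ℝ, A.F →L[ℝ] B.F) ∞ (homCoord e e' f) x ↔
    ContMDiffAt 𝓘(ℝ, E) (𝓘(ℝ, E).prod 𝓘(ℝ, A.F →L[ℝ] B.F)) ∞
      (fun x => (TotalSpace.mk' (A.F →L[ℝ] B.F) x (f x) :
        TotalSpace (A.F →L[ℝ] B.F) (fun x => A.V x →L[ℝ] B.V x))) x :=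
  (contMDiffAt_hom_iff hx hx').symm

/-- The composite of two morphisms of smooth vector bundles. -/
def VBHom.comp (g : VBHom B C) (f : VBHom A B) : VBHom A C where
  app x := (g.app x).comp (f.app x)
  smooth x := by
    have hA := FiberBundle.mem_baseSet_trivializationAt' (F := A.F) (E := A.V) x
    have hB := FiberBundle.mem_baseSet_trivializationAt' (F := B.F) (E := B.V) x
    have hC := FiberBundle.mem_baseSet_trivializationAt' (F := C.F) (E := C.V) x
    refine (contMDiffAt_homCoord_iff hA hC).mp ?_
    refine (((contMDiffAt_homCoord_iff hB hC).mpr (g.smooth x)).clm_comp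
      ((contMDiffAt_homCoord_iff hA hB).mpr (f.smooth x))).congr_of_eventuallyEq ?_
    filter_upwards [(trivializationAt B.F B.V x).open_baseSet.mem_nhds hB] with y hy
    ext w
    simp only [homCoord, ContinuousLinearMap.comp_apply,
      Trivialization.symmL_continuousLinearMapAt _ hy]

/-- The identity morphism of a smooth vector bundle. -/
def VBHom.id (A : SmoothVectorBundle.{u, v} E X) : VBHom A A where
  app x := ContinuousLinearMap.id ℝ (A.V x)
  smooth x := by
    have hA := FiberBundle.mem_baseSet_trivializationAt' (F := A.F) (E := A.V) x
    refine (contMDiffAt_homCoord_iff hA hA).mp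
      ((contMDiffAt_const (c := ContinuousLinearMap.id ℝ A.F)).congr_of_eventuallyEq ?_)
    filter_upwards [(trivializationAt A.F A.V x).open_baseSet.mem_nhds hA] with y hy
    ext w
    exact Trivialization.continuousLinearMapAt_symmL _ hy w

theorem SmoothVectorBundle.SmoothOn.map {U : Set X} {σ : ∀ x, A.V x} (hσ : A.SmoothOn U σ)
    (f : VBHom A B) : B.SmoothOn U (fun x => f.app x (σ x)) :=
  f.smooth.contMDiffOn.clm_bundle_apply hσ

/-- A morphism of bundles compatible with smooth connections has locally constant rank. -/
theorem eventually_finrank_range_eq_of_compatible [FiniteDimensional ℝ E] [T2Space X]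
    [IsManifold 𝓘(ℝ, E) ∞ X] (f : VBHom A B) (cA : CovariantDerivative 𝓘(ℝ, E) A.F A.V)
    (cB : CovariantDerivative 𝓘(ℝ, E) B.F B.V)
    (hA : CovariantDerivative.ContMDiffCovariantDerivative cA ∞)
    (hB : CovariantDerivative.ContMDiffCovariantDerivative cB ∞)
    (hf : ∀ U : Set X, IsOpen U → ∀ σ : ∀ x, A.V x, A.SmoothOn U σ → ∀ x ∈ U,
      cB (fun y => f.app y (σ y)) x = (f.app x).comp (cA σ x)) (x₀ : X) :
    ∀ᶠ x in 𝓝 x₀, Module.finrank ℝ (LinearMap.range (f.app x : A.V x →ₗ[ℝ] B.V x)) =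
      Module.finrank ℝ (LinearMap.range (f.app x₀ : A.V x₀ →ₗ[ℝ] B.V x₀)) := by
  set e := trivializationAt A.F A.V x₀
  set e' := trivializationAt B.F B.V x₀
  have he₀ : x₀ ∈ e.baseSet := FiberBundle.mem_baseSet_trivializationAt' x₀
  have he₀' : x₀ ∈ e'.baseSet := FiberBundle.mem_baseSet_trivializationAt' x₀
  obtain ⟨ΓA, hΓA, hA'⟩ := exists_connectionForm e cA hA he₀
  obtain ⟨ΓB, hΓB, hB'⟩ := exists_connectionForm e' cB hB he₀'
  set Ψ := homCoord e e' f.app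
  set τ : ∀ x, E →L[ℝ] TangentSpace 𝓘(ℝ, E) x :=
    fun x => (trivializationAt E (TangentSpace 𝓘(ℝ, E)) x₀).symmL ℝ x
  have hΨs : ∀ x ∈ e.baseSet ∩ e'.baseSet, MDifferentiableAt 𝓘(ℝ, E) 𝓘(ℝ, A.F →L[ℝ] B.F) Ψ x :=
    fun x hx => ((contMDiffAt_homCoord_iff hx.1 hx.2).mpr (f.smooth x)).mdifferentiableAt (by simp)
  -- Compatibility is evaluated on the sections with constant coordinates `w` in `e`.
  have hΨ : ∀ x ∈ e.baseSet ∩ e'.baseSet, ∀ v,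
      mvfderiv 𝓘(ℝ, E) Ψ x (τ x v) = (Ψ x).comp (ΓA x v) - (ΓB x v).comp (Ψ x) := by
    intro x hx v
    ext w
    have hσ : A.SmoothOn e.baseSet (fun y => e.symmL ℝ y w) := contMDiffOn_symmL_const e w
    have hnhds := e.open_baseSet.mem_nhds hx.1
    have h1 := hA' x hx.1 _ ((ContMDiffOn.contMDiffAt hσ hnhds).mdifferentiableAt (by simp)) v
    have h2 := hB' x hx.2 _
      ((ContMDiffOn.contMDiffAt (hσ.map f) hnhds).mdifferentiableAt (by simp)) v
    have h3 : frameCoord e (fun _ => 1) (fun y => e.symmL ℝ y w) =ᶠ[𝓝 x] fun _ => w := by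
      filter_upwards [hnhds] with y hy
      exact e.continuousLinearMapAt_symmL (R := ℝ) hy w
    have h4 : mvfderiv 𝓘(ℝ, E) (frameCoord e (fun _ => 1) (fun y => e.symmL ℝ y w)) x = 0 := by
      rw [mvfderiv, h3.mfderiv_eq]
      exact mvfderiv_const w
    have h5 := mvfderiv_clm_apply (ContinuousLinearMap.apply ℝ B.F w) (hΨs x hx)
    change mvfderiv 𝓘(ℝ, E) (frameCoord e' (fun _ => 1) fun y => f.app y (e.symmL ℝ y w)) x = _
      at h5
    rw [h4, zero_apply, zero_add, e.continuousLinearMapAt_symmL hx.1] at h1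
    rw [hf _ e.open_baseSet _ hσ x hx.1, h5] at h2
    have h6 : Ψ x (ΓA x v w) = e'.continuousLinearMapAt ℝ x (f.app x
        (cA (fun y => e.symmL ℝ y w) x (τ x v))) := by
      rw [← h1]
      simp only [Ψ, homCoord, ContinuousLinearMap.comp_apply, e.symmL_continuousLinearMapAt hx.1]
      rfl
    rw [sub_apply, ContinuousLinearMap.comp_apply, ContinuousLinearMap.comp_apply, h6]
    exact (sub_eq_of_eq_add h2).symm
  set φ := extChartAt 𝓘(ℝ, E) x₀
  have hφ0 : φ.symm (φ x₀) = x₀ := extChartAt_to_inv x₀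
  have hφc : ContinuousAt φ.symm (φ x₀) := continuousAt_extChartAt_symm x₀
  have hmem : ∀ᶠ u in 𝓝 (φ x₀), u ∈ φ.target ∧ φ.symm u ∈ e.baseSet ∩ e'.baseSet := by
    refine Filter.Eventually.and (extChartAt_target_mem_nhds x₀) (hφc.eventually ?_)
    rw [hφ0]
    exact (e.open_baseSet.inter e'.open_baseSet).mem_nhds ⟨he₀, he₀'⟩
  have hrank := eventually_clmRank_eq_of_hasFDerivAt (f := fun u => Ψ (φ.symm u))
    (f' := fun u => (mvfderiv 𝓘(ℝ, E) Ψ (φ.symm u)).comp (τ (φ.symm u)))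
    (a := fun u => ΓA (φ.symm u)) (b := fun u => ΓB (φ.symm u)) (u₀ := φ x₀)
    (ContinuousAt.comp (f := φ.symm) (hφ0.symm ▸ hΓA) hφc)
    (ContinuousAt.comp (f := φ.symm) (hφ0.symm ▸ hΓB) hφc)
    (hmem.mono fun u hu => ?_) (hmem.mono fun u hu v => hΨ _ hu.2 v)
  · have h1 := (continuousAt_extChartAt (I := 𝓘(ℝ, E)) x₀).eventually hrank
    filter_upwards [h1, e.open_baseSet.mem_nhds he₀, e'.open_baseSet.mem_nhds he₀',
      extChartAt_source_mem_nhds (I := 𝓘(ℝ, E)) x₀] with x hx hxe hxe' hxs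
    have h2 : φ.symm (φ x) = x := φ.left_inv hxs
    rw [h2, hφ0] at hx
    rwa [clmRank_homCoord hxe hxe', clmRank_homCoord he₀ he₀'] at hx
  · have h1 : MDifferentiableWithinAt 𝓘(ℝ, E) 𝓘(ℝ, E) φ.symm (Set.range 𝓘(ℝ, E)) u :=
      mdifferentiableWithinAt_extChartAt_symm hu.1
    -- The tangent frame `τ` is the differential of the inverse chart, so `hΨ` is the equation for
    -- `Ψ ∘ φ.symm` on `E`.
    have h2 : τ (φ.symm u) = mfderiv 𝓘(ℝ, E) 𝓘(ℝ, E) φ.symm u := by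
      have h3 : φ.symm u ∈ (chartAt E x₀).source := by
        rw [← extChartAt_source 𝓘(ℝ, E)]
        exact φ.map_target hu.1
      have h4 := TangentBundle.symmL_trivializationAt (I := 𝓘(ℝ, E)) h3
      rw [φ.right_inv hu.1, modelWithCornersSelf_coe, Set.range_id, mfderivWithin_univ] at h4
      exact h4
    rw [modelWithCornersSelf_coe, Set.range_id, mdifferentiableWithinAt_univ] at h1
    have h3 := ((hΨs _ hu.2).hasMFDerivAt.comp u h1.hasMFDerivAt).hasFDerivAt
    rw [← h2] at h3
    exact h3

end ConstantRank

/-! ### Path morphisms and necessity of constant rank -/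

section PathMaps

variable {E : Type*} [NormedAddCommGroup E] [NormedSpace ℝ E]
  {X : Type*} [TopologicalSpace X] [ChartedSpace E X]
  {Q : Type*} [Quiver.{w} Q] (R : QuiverBundle.{u, v} E X Q)

/-- The path morphism as a morphism of smooth vector bundles. -/
def QuiverBundle.pathHom {i j : Q} (p : Quiver.Path i j) : VBHom (R.bundle i) (R.bundle j) where
  app := R.pathMap p
  smooth := by
    induction p with
    | nil => exact (VBHom.id _).smooth
    | cons p a ih => exact ((R.map a).comp ⟨R.pathMap p, ih⟩).smooth

theorem QuiverBundle.pathMap_comp {i j k : Q} (p : Quiver.Path i j) (q : Quiver.Path j k) (x : X) :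
    R.pathMap (p.comp q) x = (R.pathMap q x).comp (R.pathMap p x) := by
  induction q with
  | nil => rfl
  | cons q a ih =>
    rw [Quiver.Path.comp_cons, QuiverBundle.pathMap, QuiverBundle.pathMap, ih]
    rfl

variable {R}

theorem RelativeConnection.pathMap_compatible [IsManifold 𝓘(ℝ, E) ∞ X] (c : RelativeConnection R)
    {i j : Q} (p : Quiver.Path i j) {U : Set X} (hU : IsOpen U) {σ : ∀ x, (R.bundle i).V x}
    (hσ : (R.bundle i).SmoothOn U σ) {x : X} (hx : x ∈ U) :
    c.conn j (fun y => R.pathMap p y (σ y)) x = (R.pathMap p x).comp (c.conn i σ x) := by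
  induction p with
  | nil => rfl
  | cons p a ih =>
    have h1 := c.compatible a U hU _ (hσ.map (R.pathHom p)) x hx
    refine h1.trans ?_
    change ((R.map a).app x).comp (c.conn _ (fun y => R.pathMap p y (σ y)) x) = _
    rw [ih]
    rfl

theorem RelativeConnection.hasConstantRank_pathMap [IsManifold 𝓘(ℝ, E) ∞ X]
    [FiniteDimensional ℝ E] [T2Space X] [PreconnectedSpace X] (c : RelativeConnection R)
    {i j : Q} (p : Quiver.Path i j) : HasConstantRank (R.pathMap p) := by
  rcases isEmpty_or_nonempty X with hX | ⟨⟨x₀⟩⟩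
  · exact ⟨0, fun x => (hX.false x).elim⟩
  have hloc : IsLocallyConstant fun x => Module.finrank ℝ
      (LinearMap.range (R.pathMap p x : (R.bundle i).V x →ₗ[ℝ] (R.bundle j).V x)) := by
    rw [IsLocallyConstant.iff_eventually_eq]
    exact fun x => eventually_finrank_range_eq_of_compatible (R.pathHom p) (c.conn i) (c.conn j)
      (c.smooth i) (c.smooth j) (fun U hU σ hσ y hy => c.pathMap_compatible p hU hσ hy) x
  exact ⟨_, fun x => hloc.apply_eq_of_preconnectedSpace x x₀⟩

end PathMaps

/-! ### Gluing local relative connections -/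

section Gluing

variable {E : Type*} [NormedAddCommGroup E] [NormedSpace ℝ E]
  {X : Type*} [TopologicalSpace X] [ChartedSpace E X]
  {Q : Type*} [Quiver.{w} Q] [IsManifold 𝓘(ℝ, E) ∞ X]

/-- A smooth relative connection over the open set `U`. -/
structure IsRelativeConnectionOn (R : QuiverBundle.{u, v} E X Q) (U : Set X)
    (c : ∀ i, (∀ x, (R.bundle i).V x) → ∀ x, TangentSpace 𝓘(ℝ, E) x →L[ℝ] (R.bundle i).V x) :
    Prop where
  isOpen : IsOpen U
  isCov : ∀ i, IsCovariantDerivativeOn (R.bundle i).F (c i) U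
  smooth : ∀ i, ContMDiffCovariantDerivativeOn (R.bundle i).F ∞ (c i) U
  compatible : ∀ {i j : Q} (a : i ⟶ j) (σ : ∀ x, (R.bundle i).V x), ∀ x ∈ U,
    MDifferentiableAt 𝓘(ℝ, E) (𝓘(ℝ, E).prod 𝓘(ℝ, (R.bundle i).F))
      (fun y => TotalSpace.mk' (R.bundle i).F y (σ y)) x →
    c j (fun y => (R.map a).app y (σ y)) x = ((R.map a).app x).comp (c i σ x)

/-- Local relative connections can be glued by a partition of unity. -/
theorem nonempty_relativeConnection_of_local [FiniteDimensional ℝ E] [T2Space X]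
    [SecondCountableTopology X] {R : QuiverBundle.{u, v} E X Q}
    (h : ∀ x₀, ∃ U c, x₀ ∈ U ∧ IsRelativeConnectionOn R U c) : Nonempty (RelativeConnection R) := by
  choose U c hmem hc using h
  have : LocallyCompactSpace X := ChartedSpace.locallyCompactSpace E X
  obtain ⟨ρ, hρ⟩ := SmoothPartitionOfUnity.exists_isSubordinate 𝓘(ℝ, E) isClosed_univ U
    (fun z => (hc z).isOpen) (fun z _ => Set.mem_iUnion.mpr ⟨z, hmem z⟩)
  let D : ∀ i, (∀ x, (R.bundle i).V x) → ∀ x, TangentSpace 𝓘(ℝ, E) x →L[ℝ] (R.bundle i).V x :=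
    fun i σ x => ∑ᶠ z, ρ z x • c z i σ x
  let T : X → Finset X := fun x => (ρ.locallyFinite.point_finite x).toFinset
  have hT : ∀ x, ∀ z ∈ T x, x ∈ U z := fun x z hz =>
    hρ z (subset_tsupport _ (by simpa [T] using hz))
  have hD : ∀ i σ x, D i σ x = ∑ z ∈ T x, ρ z x • c z i σ x := fun i σ x => by
    refine finsum_eq_sum_of_support_subset _ fun z hz => ?_
    simp only [T, Set.Finite.coe_toFinset, Set.mem_ofPred_eq]
    intro h0
    simp [show ρ z x = 0 by simpa using h0] at hz
  have hsum : ∀ x, ∑ z ∈ T x, ρ z x = 1 := fun x => by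
    rw [← ρ.sum_eq_one (Set.mem_univ x)]
    refine (finsum_eq_sum_of_support_subset _ fun z hz => ?_).symm
    simpa [T] using hz
  refine ⟨⟨fun i => ⟨D i, ⟨fun {σ σ' x} hσ hσ' _ => ?_, fun {σ g x} hσ hg _ => ?_⟩⟩,
    fun i => ⟨⟨fun {σ} hσ => ?_⟩⟩, fun {i j} a W hW σ hσ x hx => ?_⟩⟩
  · rw [hD, hD, hD, ← Finset.sum_add_distrib]
    refine Finset.sum_congr rfl fun z hz => ?_
    rw [((hc z).isCov i).add hσ hσ' (hT x z hz), smul_add]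
  -- The derivative term of the Leibniz rule must occur with total weight one: it is multiplied by
  -- `1 = ∑ ρ z x` and distributed.
  · rw [hD, hD, Finset.smul_sum, ← one_smul ℝ (ContinuousLinearMap.smulRight _ _), ← hsum x,
      Finset.sum_smul, ← Finset.sum_add_distrib]
    refine Finset.sum_congr rfl fun z hz => ?_
    rw [((hc z).isCov i).leibniz hσ hg (hT x z hz), smul_add, smul_comm]
  · rw [contMDiffOn_univ] at hσ ⊢
    refine ContMDiff.finsum_section_of_locallyFinite (ρ.locallyFinite.subset fun z x hx => ?_)
      fun z => ?_
    · intro h0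
      simp [show ρ z x = 0 by simpa using h0] at hx
    · exact ContMDiffOn.smul_section_of_tsupport (ρ z).contMDiff.contMDiffOn (hc z).isOpen (hρ z)
        (((hc z).smooth i).contMDiff (hσ.contMDiffOn))
  · change D j _ x = ((R.map a).app x).comp (D i σ x)
    rw [hD, hD]
    ext v
    simp only [ContinuousLinearMap.comp_apply, sum_apply, map_sum,
      smul_apply, map_smul]
    refine Finset.sum_congr rfl fun z hz => ?_
    rw [(hc z).compatible a σ x (hT x z hz)
      ((ContMDiffOn.contMDiffAt hσ (hW.mem_nhds hx)).mdifferentiableAt (by simp))]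
    rfl

end Gluing

/-! ### Uniqueness of paths in the linear quiver -/

section LinearQuiver

variable {n : ℕ}

theorem LinearA.eq_of_pos_eq {i j : LinearA n} (h : i.pos.val = j.pos.val) : i = j := by
  cases i; cases j
  exact congrArg LinearA.mk (Fin.ext h)

instance : Finite (LinearA n) :=
  Finite.of_injective LinearA.pos fun _ _ h => LinearA.eq_of_pos_eq (congrArg Fin.val h)

instance (i j : LinearA n) : Subsingleton (i ⟶ j) :=
  inferInstanceAs (Subsingleton (PLift _))

theorem LinearA.pos_le_of_path {i j : LinearA n} (p : Quiver.Path i j) :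
    i.pos.val ≤ j.pos.val := by
  induction p with
  | nil => exact le_rfl
  | cons p a ih => exact ih.trans (a.down ▸ Nat.le_succ _)

instance (i j : LinearA n) : Subsingleton (Quiver.Path i j) where
  allEq p q := by
    induction p with
    | nil =>
      cases q with
      | nil => rfl
      | cons q a =>
        have h1 := LinearA.pos_le_of_path q
        have h2 := a.down
        omega
    | cons p a ih =>
      cases q with
      | nil =>
        have h1 := LinearA.pos_le_of_path p
        have h2 := a.down
        omega
      | cons q b =>
        obtain rfl := LinearA.eq_of_pos_eq (Nat.succ_injective (a.down.trans b.down.symm))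
        rw [ih q, Subsingleton.elim a b]

end LinearQuiver

/-! ### Local triviality from constant ranks of paths -/

section LocalTriviality

variable {E : Type*} [NormedAddCommGroup E] [NormedSpace ℝ E]
  {X : Type*} [TopologicalSpace X] [ChartedSpace E X] {n : ℕ}
  (R : QuiverBundle.{u, v} E X (LinearA n)) (x₀ : X)

/-- The path morphism read in the preferred trivializations at `x₀`. -/
def pathCoord {i j : LinearA n} (p : Quiver.Path i j) (x : X) :
    (R.bundle i).F →L[ℝ] (R.bundle j).F :=
  homCoord (trivializationAt (R.bundle i).F (R.bundle i).V x₀)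
    (trivializationAt (R.bundle j).F (R.bundle j).V x₀) (R.pathMap p) x

/-- The smooth family of endomorphisms `G` is the identity at `x₀` and maps the kernel of each path
morphism at `x₀` to the kernel at nearby points. -/
structure PreservesPathKernels (i : LinearA n)
    (G : X → (R.bundle i).F →L[ℝ] (R.bundle i).F) : Prop where
  smoothNear : SmoothNear (E := E) G x₀
  eq_one : G x₀ = 1
  map_ker : ∀ (j : LinearA n) (p : Quiver.Path i j), ∀ᶠ x in 𝓝 x₀, ∀ v,
    pathCoord R x₀ p x₀ v = 0 → pathCoord R x₀ p x (G x v) = 0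

variable {R x₀}

theorem eventually_mem_baseSet : ∀ᶠ x in 𝓝 x₀, ∀ i,
    x ∈ (trivializationAt (R.bundle i).F (R.bundle i).V x₀).baseSet :=
  eventually_all.mpr fun i => (trivializationAt (R.bundle i).F (R.bundle i).V x₀).open_baseSet.mem_nhds
    (FiberBundle.mem_baseSet_trivializationAt' x₀)

theorem pathCoord_comp {i j k : LinearA n} (p : Quiver.Path i j) (q : Quiver.Path j k) {x : X}
    (hx : x ∈ (trivializationAt (R.bundle j).F (R.bundle j).V x₀).baseSet) (v : (R.bundle i).F) :
    pathCoord R x₀ (p.comp q) x v = pathCoord R x₀ q x (pathCoord R x₀ p x v) := by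
  simp only [pathCoord, homCoord, R.pathMap_comp, ContinuousLinearMap.comp_apply,
    Trivialization.symmL_continuousLinearMapAt _ hx]

theorem pathCoord_nil (i : LinearA n) {x : X}
    (hx : x ∈ (trivializationAt (R.bundle i).F (R.bundle i).V x₀).baseSet) (v : (R.bundle i).F) :
    pathCoord R x₀ (Quiver.Path.nil : Quiver.Path i i) x v = v :=
  Trivialization.continuousLinearMapAt_symmL _ hx v

theorem smoothNear_pathCoord {i j : LinearA n} (p : Quiver.Path i j) :
    SmoothNear (E := E) (pathCoord R x₀ p) x₀ := by
  filter_upwards [eventually_mem_baseSet (R := R)] with x hx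
  exact (contMDiffAt_homCoord_iff (hx i) (hx j)).mpr ((R.pathHom p).smooth x)

theorem eventually_clmRank_pathCoord_eq {i j : LinearA n} {p : Quiver.Path i j}
    (h : HasConstantRank (R.pathMap p)) :
    ∀ᶠ x in 𝓝 x₀, clmRank (pathCoord R x₀ p x) = clmRank (pathCoord R x₀ p x₀) := by
  obtain ⟨r, hr⟩ := h
  have hx₀ := (eventually_mem_baseSet (R := R) (x₀ := x₀)).self_of_nhds
  filter_upwards [eventually_mem_baseSet (R := R)] with x hx
  rw [pathCoord, clmRank_homCoord (hx i) (hx j), pathCoord, clmRank_homCoord (hx₀ i) (hx₀ j), hr, hr]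

variable (R x₀) in
/-- The common kernel of the path morphisms of length `r` starting at `j`; it is everything if there
is no such path. -/
def pathKer (j : LinearA n) (r : ℕ) (x : X) : Submodule ℝ (R.bundle j).F :=
  ⨅ (l : LinearA n) (p : Quiver.Path j l) (_ : l.pos.val = j.pos.val + r),
    LinearMap.ker (pathCoord R x₀ p x : (R.bundle j).F →ₗ[ℝ] (R.bundle l).F)

theorem mem_pathKer {j : LinearA n} {r : ℕ} {x : X} {v : (R.bundle j).F} :
    v ∈ pathKer R x₀ j r x ↔ ∀ (l : LinearA n) (p : Quiver.Path j l),
      l.pos.val = j.pos.val + r → pathCoord R x₀ p x v = 0 := by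
  simp [pathKer, Submodule.mem_iInf]

theorem mem_pathKer_iff_of_path {j l : LinearA n} (p : Quiver.Path j l) {r : ℕ}
    (hl : l.pos.val = j.pos.val + r) {x : X} {v : (R.bundle j).F} :
    v ∈ pathKer R x₀ j r x ↔ pathCoord R x₀ p x v = 0 := by
  rw [mem_pathKer]
  refine ⟨fun h => h l p hl, fun h l' p' hl' => ?_⟩
  obtain rfl := LinearA.eq_of_pos_eq (hl.trans hl'.symm)
  rwa [Subsingleton.elim p' p]

theorem exists_preservesPathKernels_extension
    (hR : ∀ (i j : LinearA n) (p : Quiver.Path i j), HasConstantRank (R.pathMap p))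
    (j : LinearA n) (S : Submodule ℝ (R.bundle j).F)
    (h₀ : X → (R.bundle j).F →L[ℝ] (R.bundle j).F) (h₀s : SmoothNear (E := E) h₀ x₀)
    (h₀S : ∀ v ∈ S, h₀ x₀ v = v)
    (h₀N : ∀ (l : LinearA n) (p : Quiver.Path j l), ∀ᶠ x in 𝓝 x₀, ∀ v ∈ S,
      pathCoord R x₀ p x₀ v = 0 → pathCoord R x₀ p x (h₀ x v) = 0) :
    ∃ G, PreservesPathKernels R x₀ j G ∧ ∀ x, ∀ v ∈ S, G x v = h₀ x v := by
  have hx₀ := (eventually_mem_baseSet (R := R) (x₀ := x₀)).self_of_nhds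
  have hP : ∀ r, ∃ P : X → (R.bundle j).F →L[ℝ] (R.bundle j).F, SmoothNear (E := E) P x₀ ∧
      (∀ᶠ x in 𝓝 x₀, ∀ v, P x v ∈ pathKer R x₀ j r x) ∧
      ∀ v ∈ pathKer R x₀ j r x₀, P x₀ v = v := fun r => by
    by_cases hr : ∃ (l : LinearA n) (_ : Quiver.Path j l), l.pos.val = j.pos.val + r
    · obtain ⟨l, p, hl⟩ := hr
      simp only [mem_pathKer_iff_of_path p hl]
      exact exists_smoothNear_kernel_projection (smoothNear_pathCoord p)
        (eventually_clmRank_pathCoord_eq (hR j l p))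
    · refine ⟨fun _ => ContinuousLinearMap.id ℝ _, smoothNear_const _,
        Eventually.of_forall fun x v => mem_pathKer.mpr fun l p hl => (hr ⟨l, p, hl⟩).elim,
        fun v _ => rfl⟩
  choose P hPs hPN hP using hP
  have hN0 : pathKer R x₀ j 0 x₀ = ⊥ := by
    ext v
    rw [mem_pathKer_iff_of_path Quiver.Path.nil rfl, pathCoord_nil j (hx₀ j), Submodule.mem_bot]
  have hN : ∀ r, ∀ᶠ x in 𝓝 x₀, pathKer R x₀ j r x ≤ pathKer R x₀ j (r + 1) x := fun r => by
    filter_upwards [eventually_mem_baseSet (R := R)] with x hx v hv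
    rw [mem_pathKer] at hv ⊢
    intro l p hl
    cases p with
    | nil => omega
    | @cons k _ p a =>
      have := a.down
      rw [show p.cons a = p.comp a.toPath from rfl, pathCoord_comp p a.toPath (hx k),
        hv k p (by omega), map_zero]
  obtain ⟨h, hs, hS, hid, hNr⟩ := exists_extension_preserving_chain (pathKer R x₀ j) P hPs hPN hP hN0
    hN S h₀ h₀s h₀S (fun r => by
      by_cases hr : ∃ (l : LinearA n) (_ : Quiver.Path j l), l.pos.val = j.pos.val + r
      · obtain ⟨l, p, hl⟩ := hr
        simp only [mem_pathKer_iff_of_path p hl]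
        exact h₀N l p
      · exact Eventually.of_forall fun x v _ _ =>
          mem_pathKer.mpr fun l p hl => (hr ⟨l, p, hl⟩).elim) n
  -- No path has length `n`, so the flag is exhausted at level `n` and the extension is the identity
  -- at `x₀` everywhere.
  have htop : ∀ v, v ∈ pathKer R x₀ j n x₀ := fun v => mem_pathKer.mpr fun l p hl => by
    have := l.pos.isLt
    omega
  refine ⟨h, ⟨hs, ?_, fun l p => ?_⟩, hS⟩
  · ext v
    exact hid v (Submodule.mem_sup_left (htop v))
  · obtain ⟨r, hr⟩ := Nat.exists_eq_add_of_le (LinearA.pos_le_of_path p)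
    have hrn : r ≤ n := by
      have := l.pos.isLt
      omega
    simpa only [mem_pathKer_iff_of_path p hr] using hNr r hrn

/-- The forced value on the image of the arrow is `φ x ∘ G x ∘ s`, with `s` a generalized inverse of
`φ x₀`. Its kernel condition for a path `p` is that of `G` for the arrow followed by `p`. -/
theorem exists_preservesPathKernels_of_arrow
    (hR : ∀ (i j : LinearA n) (p : Quiver.Path i j), HasConstantRank (R.pathMap p))
    {i j : LinearA n} (a : i ⟶ j) {G : X → (R.bundle i).F →L[ℝ] (R.bundle i).F}
    (hG : PreservesPathKernels R x₀ i G) :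
    ∃ G', PreservesPathKernels R x₀ j G' ∧ ∀ᶠ x in 𝓝 x₀, ∀ v,
      G' x (pathCoord R x₀ a.toPath x₀ v) = pathCoord R x₀ a.toPath x (G x v) := by
  have hx₀ := (eventually_mem_baseSet (R := R) (x₀ := x₀)).self_of_nhds
  obtain ⟨s, hs, -⟩ := exists_reflexive_inverse (pathCoord R x₀ a.toPath x₀)
  obtain ⟨G', hG', hS⟩ := exists_preservesPathKernels_extension (x₀ := x₀) hR j
    (LinearMap.range (pathCoord R x₀ a.toPath x₀ : (R.bundle i).F →ₗ[ℝ] (R.bundle j).F))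
    (fun x => (pathCoord R x₀ a.toPath x).comp ((G x).comp s))
    ((smoothNear_pathCoord a.toPath).clm_comp (hG.smoothNear.clm_comp (smoothNear_const s)))
    (by
      rintro _ ⟨v, rfl⟩
      simpa [hG.eq_one] using hs v)
    (fun l p => by
      filter_upwards [hG.map_ker l (a.toPath.comp p), eventually_mem_baseSet (R := R)] with x hx hxb
      rintro _ ⟨v, rfl⟩ hv
      have h1 := hx (s (pathCoord R x₀ a.toPath x₀ v))
        (by rw [pathCoord_comp _ _ (hx₀ j), hs]; exact hv)
      rwa [pathCoord_comp _ _ (hxb j)] at h1)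
  refine ⟨G', hG', ?_⟩
  filter_upwards [hG.map_ker j a.toPath] with x hx v
  refine (hS x _ ⟨v, rfl⟩).trans ?_
  -- Independence of the choice of `s`: two lifts differ by an element of the kernel at `x₀`, which
  -- `G` sends into the kernel at `x`.
  have h1 := hx (s (pathCoord R x₀ a.toPath x₀ v) - v) (by rw [map_sub, hs, sub_self])
  rw [map_sub, map_sub, sub_eq_zero] at h1
  exact h1

variable (x₀) in
theorem exists_preservesPathKernels_family
    (hR : ∀ (i j : LinearA n) (p : Quiver.Path i j), HasConstantRank (R.pathMap p)) :
    ∃ G : ∀ i, X → (R.bundle i).F →L[ℝ] (R.bundle i).F,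
      (∀ i, PreservesPathKernels R x₀ i (G i)) ∧ ∀ {i j : LinearA n} (a : i ⟶ j),
        ∀ᶠ x in 𝓝 x₀, ∀ v, G j x (pathCoord R x₀ a.toPath x₀ v) =
          pathCoord R x₀ a.toPath x (G i x v) := by
  classical
  suffices h : ∀ m : ℕ, ∃ G : ∀ i, X → (R.bundle i).F →L[ℝ] (R.bundle i).F,
      (∀ i, PreservesPathKernels R x₀ i (G i)) ∧ ∀ {i j : LinearA n} (a : i ⟶ j), j.pos.val < m →
        ∀ᶠ x in 𝓝 x₀, ∀ v, G j x (pathCoord R x₀ a.toPath x₀ v) =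
          pathCoord R x₀ a.toPath x (G i x v) by
    obtain ⟨G, hG, hGa⟩ := h n
    exact ⟨G, hG, fun {i j} a => hGa a j.pos.isLt⟩
  intro m
  induction m with
  | zero =>
    have h0 : ∀ i, ∃ G, PreservesPathKernels R x₀ i G := fun i => by
      obtain ⟨G, hG, -⟩ := exists_preservesPathKernels_extension (x₀ := x₀) hR i ⊥ (fun _ => 0)
        (smoothNear_const _) (fun v hv => by simp [(Submodule.mem_bot ℝ).mp hv])
        (fun l p => Eventually.of_forall fun x v _ _ => by simp)
      exact ⟨G, hG⟩
    choose G hG using h0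
    exact ⟨G, hG, fun a h => (Nat.not_lt_zero _ h).elim⟩
  | succ m ih =>
    obtain ⟨G, hG, hGa⟩ := ih
    by_cases hm : ∃ (i j : LinearA n) (_ : i ⟶ j), j.pos.val = m
    · obtain ⟨i, j, a, hj⟩ := hm
      obtain ⟨G', hG', ha⟩ := exists_preservesPathKernels_of_arrow hR a (hG i)
      -- Arrows already treated end at positions below `m`, so changing `G` at position `m` leaves
      -- their squares intact.
      have hne : ∀ k : LinearA n, k.pos.val < m → Function.update G j G' k = G k := fun k hk =>
        Function.update_of_ne (by rintro rfl; omega) _ _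
      refine ⟨Function.update G j G', fun k => ?_, fun {i' j'} b hb => ?_⟩
      · rcases eq_or_ne k j with rfl | hk
        · rwa [Function.update_self]
        · rw [Function.update_of_ne hk]
          exact hG k
      · have hb' := b.down
        have ha' := a.down
        rw [hne i' (by omega)]
        rcases Nat.lt_succ_iff_lt_or_eq.mp hb with h | h
        · rw [hne j' h]
          exact hGa b h
        · obtain rfl : j' = j := LinearA.eq_of_pos_eq (h.trans hj.symm)
          obtain rfl : i' = i := LinearA.eq_of_pos_eq (by omega)
          rw [Function.update_self, Subsingleton.elim b a]
          exact ha
    · refine ⟨G, hG, fun {i j} a h => hGa a ?_⟩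
      rcases Nat.lt_succ_iff_lt_or_eq.mp h with h | h
      · exact h
      · exact (hm ⟨i, j, a, h⟩).elim

end LocalTriviality

/-! ### The local relative connection -/

section LocalConnection

variable {E : Type*} [NormedAddCommGroup E] [NormedSpace ℝ E]
  {X : Type*} [TopologicalSpace X] [ChartedSpace E X] {n : ℕ}
  {R : QuiverBundle.{u, v} E X (LinearA n)} {x₀ : X}

theorem SmoothNear.ringInverse {A : Type*} [NormedRing A] [NormedAlgebra ℝ A] [CompleteSpace A]
    {f : X → A} (hf : SmoothNear (E := E) f x₀) (h1 : f x₀ = 1) :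
    SmoothNear (E := E) (fun x => Ring.inverse (f x)) x₀ := by
  refine hf.comp_of_eventually ?_
  filter_upwards [Units.isOpen.mem_nhds (show f x₀ ∈ {a | IsUnit a} from h1 ▸ isUnit_one)]
  rintro _ ⟨a, rfl⟩
  exact contDiffAt_ringInverse ℝ a

variable (x₀) in
theorem exists_isRelativeConnectionOn [IsManifold 𝓘(ℝ, E) ∞ X]
    (hR : ∀ (i j : LinearA n) (p : Quiver.Path i j), HasConstantRank (R.pathMap p)) :
    ∃ U c, x₀ ∈ U ∧ IsRelativeConnectionOn R U c := by
  obtain ⟨G, hG, hGa⟩ := exists_preservesPathKernels_family x₀ hR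
  have hcomplete : ∀ i, CompleteSpace (R.bundle i).F := fun i => FiniteDimensional.complete ℝ _
  have hbundle : ∀ i, ContMDiffVectorBundle 1 (R.bundle i).F (R.bundle i).V 𝓘(ℝ, E) := fun i =>
    ContMDiffVectorBundle.of_le (n := ∞) (by simp)
  let e := fun i => trivializationAt (R.bundle i).F (R.bundle i).V x₀
  let H : ∀ i, X → (R.bundle i).F →L[ℝ] (R.bundle i).F := fun i x => Ring.inverse (G i x)
  have hunit : ∀ᶠ x in 𝓝 x₀, ∀ i, IsUnit (G i x) := eventually_all.mpr fun i =>
    (hG i).smoothNear.continuousAt.eventually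
      (Units.isOpen.mem_nhds (show G i x₀ ∈ {a | IsUnit a} from (hG i).eq_one ▸ isUnit_one))
  have hsmooth : ∀ᶠ x in 𝓝 x₀, ∀ i,
      ContMDiffAt 𝓘(ℝ, E) 𝓘(ℝ, (R.bundle i).F →L[ℝ] (R.bundle i).F) ∞ (H i) x :=
    eventually_all.mpr fun i => (hG i).smoothNear.ringInverse (hG i).eq_one
  have hcomm : ∀ᶠ x in 𝓝 x₀, ∀ (i j : LinearA n) (a : i ⟶ j), ∀ v,
      G j x (pathCoord R x₀ a.toPath x₀ v) = pathCoord R x₀ a.toPath x (G i x v) :=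
    eventually_all.mpr fun i => eventually_all.mpr fun j => eventually_all.mpr fun a => hGa a
  obtain ⟨U, hU, hUo, hx₀⟩ := eventually_nhds_iff.mp
    ((eventually_mem_baseSet (R := R)).and (hunit.and (hsmooth.and hcomm)))
  have hHu : ∀ x ∈ U, ∀ i, IsUnit (H i x) := fun x hx i => ((hU x hx).2.1 i).ringInverse
  have hGH : ∀ x ∈ U, ∀ i v, G i x (H i x v) = v := fun x hx i v =>
    DFunLike.congr_fun (Ring.mul_inverse_cancel _ ((hU x hx).2.1 i)) v
  have hHG : ∀ x ∈ U, ∀ i v, H i x (G i x v) = v := fun x hx i v =>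
    DFunLike.congr_fun (Ring.inverse_mul_cancel _ ((hU x hx).2.1 i)) v
  refine ⟨U, fun i => frameCov (e i) (H i), hx₀, hUo, fun i => ?_, fun i => ?_, ?_⟩
  · exact frameCov_isCovariantDerivativeOn (fun x hx => (hU x hx).1 i)
      (fun x hx => ((hU x hx).2.2.1 i).mdifferentiableAt (by simp)) (fun x hx => hHu x hx i)
  · exact frameCov_contMDiffCovariantDerivativeOn hUo (fun x hx => (hU x hx).1 i)
      (fun x hx => (hU x hx).2.2.1 i) (fun x hx => hHu x hx i)
  · intro i j a σ x hx hσ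
    let L := pathCoord R x₀ a.toPath x₀
    have hmap : ∀ y ∈ U, ∀ v, pathCoord R x₀ a.toPath y ((e i).continuousLinearMapAt ℝ y v) =
        (e j).continuousLinearMapAt ℝ y ((R.map a).app y v) := fun y hy v => by
      change (e j).continuousLinearMapAt ℝ y ((R.map a).app y ((e i).symmL ℝ y _)) = _
      rw [Trivialization.symmL_continuousLinearMapAt _ ((hU y hy).1 i)]
    -- In the frames twisted by `H = G⁻¹` the arrow becomes the constant matrix `L`, which commutes
    -- with differentiation.
    have hcoord : frameCoord (e j) (H j) (fun y => (R.map a).app y (σ y)) =ᶠ[𝓝 x]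
        fun y => L (frameCoord (e i) (H i) σ y) := by
      filter_upwards [hUo.mem_nhds hx] with y hy
      have h1 := (hU y hy).2.2.2 i j a (H i y ((e i).continuousLinearMapAt ℝ y (σ y)))
      rw [hGH y hy, hmap y hy] at h1
      rw [frameCoord, ← h1, hHG y hy]
      rfl
    have hdiff := frameCoord_mdifferentiableAt ((hU x hx).1 i)
      (((hU x hx).2.2.1 i).mdifferentiableAt (by simp)) hσ
    have hinv : ∀ k, Ring.inverse (H k x) = G k x := fun k =>
      Ring.inverse_inverse ((hU x hx).2.1 k)
    have hd : mvfderiv 𝓘(ℝ, E) (frameCoord (e j) (H j) (fun y => (R.map a).app y (σ y))) x =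
        L.comp (mvfderiv 𝓘(ℝ, E) (frameCoord (e i) (H i) σ) x) := by
      rw [← mvfderiv_clm_apply L hdiff]
      exact hcoord.mfderiv_eq
    simp only [frameCov]
    rw [hd, hinv, hinv]
    ext w
    simp only [ContinuousLinearMap.comp_apply]
    rw [(hU x hx).2.2.2 i j a]
    change (e j).symmL ℝ x ((e j).continuousLinearMapAt ℝ x ((R.map a).app x _)) = _
    rw [Trivialization.symmL_continuousLinearMapAt _ ((hU x hx).1 j)]
    rfl

end LocalConnection

end QuiverConn

end

theorem propositionT (n : ℕ)
    {E : Type*} [NormedAddCommGroup E] [NormedSpace ℝ E] [FiniteDimensional ℝ E]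
    {X : Type*} [TopologicalSpace X] [T2Space X] [SecondCountableTopology X] [ConnectedSpace X]
    [ChartedSpace E X] [IsManifold 𝓘(ℝ, E) ∞ X]
    (R : QuiverConn.QuiverBundle.{u, v} E X (QuiverConn.LinearA n)) :
    Nonempty (QuiverConn.RelativeConnection R) ↔
      ∀ (i j : QuiverConn.LinearA n) (p : Quiver.Path i j),
        QuiverConn.HasConstantRank (R.pathMap p) :=
  ⟨fun ⟨c⟩ _ _ p => c.hasConstantRank_pathMap p, fun h =>
    QuiverConn.nonempty_relativeConnection_of_local fun x₀ =>
      QuiverConn.exists_isRelativeConnectionOn x₀ h⟩
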